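/- Let $\varphi,\chi$ be smooth real functions on $[0,\infty)$ with $\operatorname{supp}\varphi\subset[\frac34,\frac83]$, $\operatorname{supp}\chi\subset[0,\frac43]$, $\sum_{j\in\mathbb Z}\varphi(2^{-j}t)=1$ for $t>0$ and $\chi(t)+\sum_{j\ge0}\varphi(2^{-j}t)=1$ for $t\ge0$. On $\mathcal S'(\mathbb R^2)$ let $\Delta_j,\ S_j,\ \Delta_k^h,\ S_k^h$ ($j,k\in\mathbb Z$) be the Fourier multipliers with symbols $\varphi(2^{-j}|\xi|)$, $\chi(2^{-j}|\xi|)$, $\varphi(2^{-k}|\xi_1|)$, $\chi(2^{-k}|\xi_1|)$ respectively. For $s,\tau\in\mathbb R$ put $$\|u\|_{\mathcal B^{s,\tau}}=\sum_{j,k\in\mathbb Z}2^{js}2^{k\tau}\|\Delta_j\Delta_k^hu\|_{L^2(\mathbb R^2)},$$ and let $\mathcal B^{s,\tau}(\mathbb R^2)$ be the set of $u\in\mathcal S'(\mathbb R^2)$ such that $\|u\|_{\mathcal B^{s,\tau}}<\infty$ and $S_k^hu\to0$ in $\mathcal S'(\mathbb R^2)$ as $k\to-\infty$. The product of two tempered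 distributions $a,b$ is $ab=\lim_{n\to\infty}S_na\,S_nb$ in $\mathcal S'(\mathbb R^2)$, whenever this limit exists ($S_na$ and $S_nb$ are smooth functions). **Lemma.** Let $s_1,s_2,\tau_1,\tau_2\in\mathbb R$ satisfy $s_1,s_2\le\frac12$, $\tau_1,\tau_2\le\frac12$, $s_1+s_2>0$ and $\tau_1+\tau_2>0$. Then there is a constant $C$, depending only on $s_1,s_2,\tau_1,\tau_2,\varphi,\chi$, such that for all $a\in\mathcal B^{s_1,\tau_1}(\mathbb R^2)$ and $b\in\mathcal B^{s_2,\tau_2}(\mathbb R^2)$ the product $ab$ exists, belongs to $\mathcal B^{s_1+s_2-\frac12,\tau_1+\tau_2-\frac12}(\mathbb R^2)$, and $$\|ab\|_{\mathcal B^{s_1+s_2-\frac12,\,\tau_1+\tau_2-\frac12}}\le C\,\|a\|_{\mathcal B^{s_1,\tau_1}}\|b\|_{\mathcal B^{s_2,\tau_2}}.$$ -/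

import Mathlib

open MeasureTheory Filter Topology SchwartzMap
open scoped ENNReal NNReal ContDiff

noncomputable section

namespace AnisoBesov

/-- The plane `ℝ²` with coordinates `x 0` (horizontal) and `x 1` (vertical). -/
abbrev Plane : Type := EuclideanSpace ℝ (Fin 2)

/-- A pair of profiles for a dyadic partition of unity on `[0, ∞)`: `φ` lives on the ring
`3/4 ≤ t ≤ 8/3`, `χ` on the ball `t ≤ 4/3`. Only the values at `t ≥ 0` are ever used. -/
structure IsDyadicPartition (φ χ : ℝ → ℝ) : Prop where
  smooth_ring : ContDiff ℝ ∞ φ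
  smooth_ball : ContDiff ℝ ∞ χ
  support_ring : Function.support φ ⊆ Set.Icc (3 / 4) (8 / 3)
  support_ball : Function.support χ ⊆ Set.Iic (4 / 3)
  sum_homogeneous : ∀ t : ℝ, 0 < t → HasSum (fun j : ℤ => φ ((2 : ℝ) ^ (-j) * t)) 1
  sum_inhomogeneous : ∀ t : ℝ, 0 ≤ t →
    HasSum (fun j : ℕ => φ ((2 : ℝ) ^ (-(j : ℤ)) * t)) (1 - χ t)

/-- The Fourier multiplier `m(D)` on tempered distributions, for the normalisation
`û(ξ) = ∫ u(x) exp (-i x·ξ) dx`; Mathlib's transform uses `exp (-2πi x·ξ)`, whence the `2π`. -/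
def multiplier (m : Plane → ℝ) : 𝓢'(Plane, ℂ) →L[ℂ] 𝓢'(Plane, ℂ) :=
  TemperedDistribution.fourierMultiplierCLM ℂ
    (fun ξ : Plane => ((m ((2 * Real.pi) • ξ) : ℝ) : ℂ))

/-- The isotropic dyadic block `Δ_j` with symbol `φ (2^{-j} |ξ|)`; with `χ` in the place
of `φ` it is the low frequency cut-off `S_j`. -/
def isoBlock (φ : ℝ → ℝ) (j : ℤ) : 𝓢'(Plane, ℂ) →L[ℂ] 𝓢'(Plane, ℂ) :=
  multiplier (fun ξ => φ ((2 : ℝ) ^ (-j) * ‖ξ‖))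

/-- The horizontal dyadic block `Δ_k^h` with symbol `φ (2^{-k} |ξ₁|)`; with `χ` in the place
of `φ` it is the horizontal low frequency cut-off `S_k^h`. -/
def horBlock (φ : ℝ → ℝ) (k : ℤ) : 𝓢'(Plane, ℂ) →L[ℂ] 𝓢'(Plane, ℂ) :=
  multiplier (fun ξ => φ ((2 : ℝ) ^ (-k) * |ξ 0|))

/-- The `L²` norm of a tempered distribution, `∞` when it is not given by an `L²` function. -/
def l2Norm (u : 𝓢'(Plane, ℂ)) : ℝ≥0∞ :=
  ⨅ (f : Lp ℂ 2 (volume : Measure Plane)) (_ : Lp.toTemperedDistribution f = u), ‖f‖ₑ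

/-- `‖u‖_{𝓑^{s,τ}} = ∑_{j,k ∈ ℤ} 2^{js} 2^{kτ} ‖Δ_j Δ_k^h u‖_{L²}`, with values in `[0, ∞]`. -/
def besovNorm (φ : ℝ → ℝ) (s τ : ℝ) (u : 𝓢'(Plane, ℂ)) : ℝ≥0∞ :=
  ∑' p : ℤ × ℤ, (2 : ℝ≥0∞) ^ ((p.1 : ℝ) * s) * (2 : ℝ≥0∞) ^ ((p.2 : ℝ) * τ) *
    l2Norm (isoBlock φ p.1 (horBlock φ p.2 u))

/-- Membership in `𝓑^{s,τ}(ℝ²)`: the norm is finite and `S_k^h u → 0` in `𝓢'` as `k → -∞`.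
The second condition is the usual low frequency condition of homogeneous spaces; it removes the
distributions with horizontal frequency zero, such as constants and functions of `x₂` alone,
which the dyadic blocks do not see. -/
def MemBesov (φ χ : ℝ → ℝ) (s τ : ℝ) (u : 𝓢'(Plane, ℂ)) : Prop :=
  besovNorm φ s τ u < ⊤ ∧ Tendsto (fun k : ℤ => horBlock χ k u) atBot (𝓝 0)

/-- `p` is the product `a b`: `S_n a · S_n b → p` in `𝓢'` as `n → ∞`. Here `S_n a` is
represented by a smooth function `A n` of temperate growth, which multiplies `S_n b`. -/
def IsProduct (χ : ℝ → ℝ) (a b p : 𝓢'(Plane, ℂ)) : Prop :=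
  ∃ (A : ℕ → Plane → ℂ) (hA : ∀ n, (A n).HasTemperateGrowth),
    (∀ n : ℕ, (hA n).toTemperedDistribution = isoBlock χ n a) ∧
    Tendsto (fun n : ℕ => TemperedDistribution.smulLeftCLM ℂ (A n) (isoBlock χ n b))
      atTop (𝓝 p)

end AnisoBesov

end

/-! On the Fourier side the lemma is a weighted L² estimate for convolutions, and no paraproduct
decomposition is needed. The dyadic blocks see every frequency with ξ₁ ≠ 0, and the condition S_k^h
a → 0 excludes anything carried by the line ξ₁ = 0. Hence an element a of the space is described by
a frequency function F (`exists_frequency`), and s, τ ≤ 1/2 makes F integrable against a negative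
power of 1 + |ξ|². The Besov norm of a is comparable to `tileNorm` of |F|, built on the sharp tiles
|ξ| ~ 2^j, |ξ₁| ~ 2^k. The product is the inverse transform of F ⋆ G, and |F ⋆ G| ≤ |F| ⋆ |G|, so it
is enough to convolve nonnegative functions (`exists_tileNorm_lconvolution_le`).

A tile (j,k) lies in a box with sides of order 2^k and 2^j. For pieces on tiles (j,k) and (l,m),
with output restricted to the tile (p,q), Cauchy–Schwarz therefore gains 2^{min(j,l,p)/2}
2^{min(k,m,q)/2} (`lTwo_tile_lconvolution_le`), and the triangle inequality makes the two largest of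
j, l, p comparable, likewise for k, m, q. The isotropic and horizontal factors separate, which
leaves a one-dimensional sum over p (`exists_tsum_gain_le`). If l ≤ j, either p is close to j, and
s₂ ≤ 1/2 suffices, or l is close to j while p runs over all p ≤ j + 1, and s₁ + s₂ > 0 gives a
geometric series.

For the existence of the product, |F| ⋆ |G| has finite `tileNorm` with indices at most 1/2, so it is
itself tempered and dominates the convolutions of the truncated frequency functions; dominated
convergence identifies the limit of S_n a · S_n b. -/

noncomputable section

namespace AnisoBesov

/-! ### L² norms of functions with values in [0, ∞]. -/

section LTwo

variable {α β : Type*} [MeasurableSpace α] [MeasurableSpace β]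

/-- The `L²` norm of a function with values in `[0, ∞]`. -/
def lTwo (μ : Measure α) (f : α → ℝ≥0∞) : ℝ≥0∞ :=
  (∫⁻ x, f x ^ (2 : ℝ) ∂μ) ^ (1 / 2 : ℝ)

variable {μ : Measure α} {ν : Measure β}

lemma lTwo_rpow_two (f : α → ℝ≥0∞) : lTwo μ f ^ (2 : ℝ) = ∫⁻ x, f x ^ (2 : ℝ) ∂μ := by
  rw [lTwo, ← ENNReal.rpow_mul]; norm_num

lemma lTwo_mono_ae {f g : α → ℝ≥0∞} (h : ∀ᵐ x ∂μ, f x ≤ g x) : lTwo μ f ≤ lTwo μ g := by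
  unfold lTwo
  gcongr ?_ ^ _
  refine lintegral_mono_ae ?_
  filter_upwards [h] with x hx
  gcongr

lemma lTwo_mono {f g : α → ℝ≥0∞} (h : ∀ x, f x ≤ g x) : lTwo μ f ≤ lTwo μ g :=
  lTwo_mono_ae (ae_of_all _ h)

lemma lTwo_congr_ae {f g : α → ℝ≥0∞} (h : ∀ᵐ x ∂μ, f x = g x) : lTwo μ f = lTwo μ g :=
  le_antisymm (lTwo_mono_ae (h.mono fun _ hx => hx.le)) (lTwo_mono_ae (h.mono fun _ hx => hx.ge))

lemma lTwo_const_mul (c : ℝ≥0∞) {f : α → ℝ≥0∞} (hf : Measurable f) :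
    lTwo μ (fun x => c * f x) = c * lTwo μ f := by
  unfold lTwo
  simp_rw [ENNReal.mul_rpow_of_nonneg _ _ zero_le_two]
  rw [lintegral_const_mul _ (by fun_prop), ENNReal.mul_rpow_of_nonneg _ _ (by norm_num),
    ← ENNReal.rpow_mul]
  norm_num

lemma lTwo_zero : lTwo μ (fun _ => 0) = 0 := by
  simp [lTwo]

lemma lTwo_add_le {f g : α → ℝ≥0∞} (hf : Measurable f) (hg : Measurable g) :
    lTwo μ (fun x => f x + g x) ≤ lTwo μ f + lTwo μ g :=
  ENNReal.lintegral_Lp_add_le hf.aemeasurable hg.aemeasurable one_le_two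

lemma lTwo_sum_le {ι : Type*} (s : Finset ι) {f : ι → α → ℝ≥0∞} (hf : ∀ i, Measurable (f i)) :
    lTwo μ (fun x => ∑ i ∈ s, f i x) ≤ ∑ i ∈ s, lTwo μ (f i) := by
  classical
  induction s using Finset.induction_on with
  | empty => simp [lTwo_zero]
  | insert a s ha ih =>
    simp only [Finset.sum_insert ha]
    exact (lTwo_add_le (hf a) (Finset.measurable_sum _ fun i _ => hf i)).trans (by gcongr)

/-- Minkowski for finite sums, then monotone convergence along the directed family of finite
subsets. -/
lemma lTwo_tsum_le {ι : Type*} [Countable ι] {f : ι → α → ℝ≥0∞} (hf : ∀ i, Measurable (f i)) :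
    lTwo μ (fun x => ∑' i, f i x) ≤ ∑' i, lTwo μ (f i) := by
  have key : lTwo μ (fun x => ∑' i, f i x) = ⨆ s : Finset ι, lTwo μ (fun x => ∑ i ∈ s, f i x) := by
    unfold lTwo
    simp_rw [ENNReal.tsum_eq_iSup_sum]
    have h1 : ∀ x, (⨆ s : Finset ι, ∑ i ∈ s, f i x) ^ (2 : ℝ)
        = ⨆ s : Finset ι, (∑ i ∈ s, f i x) ^ (2 : ℝ) := fun x =>
      (ENNReal.orderIsoRpow 2 zero_lt_two).map_iSup _
    simp_rw [h1]
    rw [lintegral_iSup_directed]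
    · exact (ENNReal.orderIsoRpow (1 / 2) (by norm_num)).map_iSup _
    · intro s
      exact ((Finset.measurable_sum _ fun i _ => hf i).pow_const _).aemeasurable
    · refine Monotone.directed_le fun s t hst x => ?_
      dsimp only
      gcongr
  rw [key]
  exact iSup_le fun s => (lTwo_sum_le s hf).trans (ENNReal.sum_le_tsum s)

lemma lintegral_mul_le_lTwo {f g : α → ℝ≥0∞} (hf : Measurable f) (hg : Measurable g) :
    ∫⁻ x, f x * g x ∂μ ≤ lTwo μ f * lTwo μ g :=
  ENNReal.lintegral_mul_le_Lp_mul_Lq μ Real.HolderConjugate.two_two hf.aemeasurable hg.aemeasurable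

lemma lintegral_le_measure_support_mul_lTwo {f : α → ℝ≥0∞} (hf : Measurable f) {K : ℝ≥0∞}
    (hK : μ (Function.support f) ≤ K) : ∫⁻ x, f x ∂μ ≤ K ^ (1 / 2 : ℝ) * lTwo μ f := by
  have hS : MeasurableSet (Function.support f) := measurableSet_support hf
  calc ∫⁻ x, f x ∂μ = ∫⁻ x, (Function.support f).indicator 1 x * f x ∂μ := by
        congr with x
        by_cases hx : f x = 0
        · simp [hx]
        · rw [Set.indicator_of_mem (Function.mem_support.2 hx)]; simp
    _ ≤ lTwo μ ((Function.support f).indicator 1) * lTwo μ f :=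
        lintegral_mul_le_lTwo (measurable_one.indicator hS) hf
    _ ≤ K ^ (1 / 2 : ℝ) * lTwo μ f := by
        gcongr
        unfold lTwo
        gcongr
        refine le_trans (le_of_eq ?_) hK
        rw [← lintegral_indicator_one hS]
        congr with x
        by_cases hx : x ∈ Function.support f <;> simp [hx]

/-- A bilinear Cauchy–Schwarz bound for an integral operator whose kernel charges sets of measure
at most `K` only. -/
lemma lTwo_lintegral_mul_le [SFinite μ] [SFinite ν] {u : α → ℝ≥0∞} {W : β → α → ℝ≥0∞}
    {K B : ℝ≥0∞} (hu : Measurable u) (hW : Measurable (Function.uncurry W))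
    (hK : ∀ y, μ (Function.support fun x => u x * W y x) ≤ K)
    (hB : ∀ x, lTwo ν (fun y => W y x) ≤ B) :
    lTwo ν (fun y => ∫⁻ x, u x * W y x ∂μ) ≤ K ^ (1 / 2 : ℝ) * (lTwo μ u * B) := by
  have hW' : ∀ y, Measurable (W y) := fun y => hW.of_uncurry_left
  have hmeas : Measurable (Function.uncurry fun y x => (u x * W y x) ^ (2 : ℝ)) := by
    have : Measurable fun p : β × α => Function.uncurry W p := hW
    have h2 : Measurable fun p : β × α => (u p.2 * Function.uncurry W p) ^ (2 : ℝ) := by fun_prop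
    exact h2
  -- Cauchy–Schwarz against the indicator of the support, which costs K^{1/2}.
  have h1 : ∀ y, ∫⁻ x, u x * W y x ∂μ ≤ K ^ (1 / 2 : ℝ) * lTwo μ (fun x => u x * W y x) := fun y =>
    lintegral_le_measure_support_mul_lTwo (hu.mul (hW' y)) (hK y)
  have h2 : Measurable fun y => lTwo μ (fun x => u x * W y x) :=
    (Measurable.lintegral_prod_right hmeas).pow_const _
  calc lTwo ν (fun y => ∫⁻ x, u x * W y x ∂μ)
      ≤ lTwo ν (fun y => K ^ (1 / 2 : ℝ) * lTwo μ (fun x => u x * W y x)) := lTwo_mono h1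
    _ = K ^ (1 / 2 : ℝ) * lTwo ν (fun y => lTwo μ (fun x => u x * W y x)) := lTwo_const_mul _ h2
    _ ≤ K ^ (1 / 2 : ℝ) * (lTwo μ u * B) := by
        gcongr
        -- Tonelli: integrating in y first leaves the L² norm of W in y, bounded by B uniformly in
        -- x.
        have h3 : ∫⁻ y, lTwo μ (fun x => u x * W y x) ^ (2 : ℝ) ∂ν ≤ (lTwo μ u * B) ^ (2 : ℝ) := by
          simp_rw [lTwo_rpow_two]
          rw [lintegral_lintegral_swap hmeas.aemeasurable, ENNReal.mul_rpow_of_nonneg _ _ zero_le_two,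
            lTwo_rpow_two, ← lintegral_mul_const _ (by fun_prop)]
          gcongr with x
          simp_rw [ENNReal.mul_rpow_of_nonneg _ _ zero_le_two]
          rw [lintegral_const_mul]
          · gcongr
            rw [← lTwo_rpow_two]
            gcongr
            exact hB x
          · exact (hW.of_uncurry_right).pow_const _
        calc lTwo ν (fun y => lTwo μ (fun x => u x * W y x))
            ≤ ((lTwo μ u * B) ^ (2 : ℝ)) ^ (1 / 2 : ℝ) := by
              conv_lhs => unfold lTwo
              gcongr
              exact h3
          _ = lTwo μ u * B := by rw [← ENNReal.rpow_mul]; norm_num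

end LTwo

section TwoPow

lemma two_rpow_ne_zero (x : ℝ) : (2 : ℝ≥0∞) ^ x ≠ 0 := by
  simp [ENNReal.rpow_eq_zero_iff]

lemma two_rpow_ne_top (x : ℝ) : (2 : ℝ≥0∞) ^ x ≠ ⊤ := by
  simp [ENNReal.rpow_eq_top_iff]

lemma two_rpow_add (x y : ℝ) : (2 : ℝ≥0∞) ^ (x + y) = 2 ^ x * 2 ^ y :=
  ENNReal.rpow_add x y (by simp) (by simp)

lemma two_rpow_mono {x y : ℝ} (h : x ≤ y) : (2 : ℝ≥0∞) ^ x ≤ 2 ^ y :=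
  ENNReal.rpow_le_rpow_of_exponent_le (by norm_num) h

lemma ofReal_two_zpow (n : ℤ) : ENNReal.ofReal ((2 : ℝ) ^ n) = 2 ^ (n : ℝ) := by
  rw [← Real.rpow_intCast, ← ENNReal.ofReal_rpow_of_pos two_pos]
  simp

end TwoPow

/-! ### Dyadic frequency tiles and the convolution of tile-supported functions. -/

section Tiles

lemma volume_box_le (c : Plane) (r r' : ℝ) :
    volume {x : Plane | |x 0 - c 0| ≤ r ∧ |x 1 - c 1| ≤ r'} ≤
      ENNReal.ofReal (2 * r) * ENNReal.ofReal (2 * r') := by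
  have hmp := EuclideanSpace.volume_preserving_symm_measurableEquiv_toLp (Fin 2)
  set S : Set Plane := {x : Plane | |x 0 - c 0| ≤ r ∧ |x 1 - c 1| ≤ r'}
  have hS : S = (MeasurableEquiv.toLp 2 (Fin 2 → ℝ)).symm ⁻¹'
      (Set.Icc ![c 0 - r, c 1 - r'] ![c 0 + r, c 1 + r']) := by
    ext x
    simp only [S, Set.mem_ofPred_eq, Set.mem_preimage, Set.mem_Icc, Pi.le_def, Fin.forall_fin_two,
      abs_le]
    simp
    constructor
    · rintro ⟨⟨h1, h2⟩, h3, h4⟩; refine ⟨⟨?_, ?_⟩, ?_, ?_⟩ <;> linarith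
    · rintro ⟨⟨h1, h2⟩, h3, h4⟩; refine ⟨⟨?_, ?_⟩, ?_, ?_⟩ <;> linarith
  rw [hS, hmp.measure_preimage_equiv, Real.volume_Icc_pi, Fin.prod_univ_two]
  simp only [Matrix.cons_val_zero, Matrix.cons_val_one]
  gcongr <;> linarith

/-- The dyadic tile `2^j ≤ 2π|ξ| < 2^{j+1}`, `2^k ≤ 2π|ξ₁| < 2^{k+1}`. -/
def tile (j k : ℤ) : Set Plane :=
  {ξ | ((2 : ℝ) ^ j ≤ ‖(2 * Real.pi) • ξ‖ ∧ ‖(2 * Real.pi) • ξ‖ < 2 ^ (j + 1)) ∧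
    (2 : ℝ) ^ k ≤ |((2 * Real.pi) • ξ) 0| ∧ |((2 * Real.pi) • ξ) 0| < 2 ^ (k + 1)}

lemma measurableSet_tile (j k : ℤ) : MeasurableSet (tile j k) := by
  have h1 : Measurable fun ξ : Plane => ‖(2 * Real.pi) • ξ‖ := by fun_prop
  have h2 : Measurable fun ξ : Plane => |((2 * Real.pi) • ξ) 0| := by
    have : Continuous fun ξ : Plane => |((2 * Real.pi) • ξ) 0| := by fun_prop
    exact this.measurable
  exact ((measurableSet_le measurable_const h1).inter (measurableSet_lt h1 measurable_const)).inter
    ((measurableSet_le measurable_const h2).inter (measurableSet_lt h2 measurable_const))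

lemma abs_le_abs_two_pi_mul (x : ℝ) : |x| ≤ |2 * Real.pi * x| := by
  rw [abs_mul, abs_of_pos Real.two_pi_pos]
  nlinarith [abs_nonneg x, Real.pi_gt_three]

lemma abs_zero_le_of_mem_tile {j k : ℤ} {ξ : Plane} (h : ξ ∈ tile j k) : |ξ 0| ≤ 2 ^ (k + 1) := by
  have := h.2.2
  simp only [PiLp.smul_apply, smul_eq_mul] at this
  exact (abs_le_abs_two_pi_mul _).trans this.le

lemma abs_one_le_of_mem_tile {j k : ℤ} {ξ : Plane} (h : ξ ∈ tile j k) : |ξ 1| ≤ 2 ^ (j + 1) := by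
  have h1 := h.1.2
  have h2 := PiLp.norm_apply_le ((2 * Real.pi) • ξ) 1
  simp only [PiLp.smul_apply, smul_eq_mul, Real.norm_eq_abs] at h2
  exact (abs_le_abs_two_pi_mul _).trans (h2.trans h1.le)

/-- In each coordinate, S lies in an interval about 0 and in one about z; keeping the shorter one
gives a box whose sides are 4 times a power of 2, whence 16. -/
lemma volume_le_of_subset_two_boxes {S : Set Plane} {j k l m : ℤ} {z : Plane}
    (h0 : ∀ x ∈ S, |x 0| ≤ 2 ^ (k + 1)) (h1 : ∀ x ∈ S, |x 1| ≤ 2 ^ (j + 1))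
    (h2 : ∀ x ∈ S, |x 0 - z 0| ≤ 2 ^ (m + 1)) (h3 : ∀ x ∈ S, |x 1 - z 1| ≤ 2 ^ (l + 1)) :
    volume S ≤ 16 * (2 ^ ((min j l : ℤ) : ℝ) * 2 ^ ((min k m : ℤ) : ℝ)) := by
  set c : Plane := !₂[if k ≤ m then 0 else z 0, if j ≤ l then 0 else z 1]
  have hsub : S ⊆ {x : Plane | |x 0 - c 0| ≤ 2 ^ (min k m + 1) ∧
      |x 1 - c 1| ≤ 2 ^ (min j l + 1)} := by
    intro x hx
    constructor
    · by_cases hkm : k ≤ m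
      · simpa [c, hkm] using h0 x hx
      · simpa [c, hkm, min_eq_right (not_le.1 hkm).le] using h2 x hx
    · by_cases hjl : j ≤ l
      · simpa [c, hjl] using h1 x hx
      · simpa [c, hjl, min_eq_right (not_le.1 hjl).le] using h3 x hx
  refine (measure_mono hsub).trans ((volume_box_le c _ _).trans (le_of_eq ?_))
  have h4 : ∀ n : ℤ, ENNReal.ofReal (2 * (2 : ℝ) ^ (n + 1)) = 4 * 2 ^ (n : ℝ) := by
    intro n
    rw [zpow_add_one₀ (by norm_num), show (2 : ℝ) * (2 ^ n * 2) = 4 * 2 ^ n by ring,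
      ENNReal.ofReal_mul (by norm_num), ofReal_two_zpow]
    simp
  rw [h4, h4]
  ring_nf

lemma sixteen_mul_rpow_half (x y : ℝ) :
    (16 * ((2 : ℝ≥0∞) ^ x * 2 ^ y)) ^ (1 / 2 : ℝ) = 4 * (2 ^ (x / 2) * 2 ^ (y / 2)) := by
  rw [ENNReal.mul_rpow_of_nonneg _ _ (by norm_num), ENNReal.mul_rpow_of_nonneg _ _ (by norm_num),
    ← ENNReal.rpow_mul, ← ENNReal.rpow_mul]
  congr 1
  · rw [show (16 : ℝ≥0∞) = 4 ^ (2 : ℝ) by norm_num, ← ENNReal.rpow_mul]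
    norm_num
  · congr 2 <;> ring

/-- Convolution of functions supported in two tiles: frequency supports of the factors only. -/
lemma lTwo_lconvolution_le {u v : Plane → ℝ≥0∞} {j k l m : ℤ} (hu : Measurable u)
    (hv : Measurable v) (hu' : Function.support u ⊆ tile j k)
    (hv' : Function.support v ⊆ tile l m) :
    lTwo volume (u ⋆ₗ v) ≤
      4 * (2 ^ (((min j l : ℤ) : ℝ) / 2) * 2 ^ (((min k m : ℤ) : ℝ) / 2)) *
        (lTwo volume u * lTwo volume v) := by
  rw [← sixteen_mul_rpow_half]
  refine lTwo_lintegral_mul_le (W := fun z x => v (-x + z)) hu ?_ (fun z => ?_) (fun x => ?_)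
  · exact hv.comp (by fun_prop)
  -- For fixed z the kernel lives on a tile intersected with a reflected and translated tile.
  · have hmem : ∀ x ∈ Function.support (fun x => u x * v (-x + z)),
        x ∈ tile j k ∧ -x + z ∈ tile l m := fun x hx =>
      ⟨hu' (left_ne_zero_of_mul hx), hv' (right_ne_zero_of_mul hx)⟩
    refine volume_le_of_subset_two_boxes (z := z)
      (fun x hx => abs_zero_le_of_mem_tile (hmem x hx).1)
      (fun x hx => abs_one_le_of_mem_tile (hmem x hx).1) (fun x hx => ?_) (fun x hx => ?_)
    · have := abs_zero_le_of_mem_tile (hmem x hx).2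
      rw [abs_sub_comm]
      simpa [neg_add_eq_sub] using this
    · have := abs_one_le_of_mem_tile (hmem x hx).2
      rw [abs_sub_comm]
      simpa [neg_add_eq_sub] using this
  · unfold lTwo
    rw [lintegral_add_left_eq_self (fun z => v z ^ (2 : ℝ)) (-x)]

/-- Qualitative only: u ⋆ v is bounded by Cauchy–Schwarz and a tile has finite volume. The
finiteness permits the division by this norm in the duality argument of
`lTwo_indicator_lconvolution_le`. -/
lemma lTwo_indicator_lconvolution_ne_top {u v : Plane → ℝ≥0∞} (p q : ℤ) (hu : Measurable u)
    (hv : Measurable v) (hu2 : lTwo volume u ≠ ⊤) (hv2 : lTwo volume v ≠ ⊤) :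
    lTwo volume ((tile p q).indicator (u ⋆ₗ v)) ≠ ⊤ := by
  have h1 : ∀ z, (u ⋆ₗ v) z ≤ lTwo volume u * lTwo volume v := by
    intro z
    refine (lintegral_mul_le_lTwo hu (hv.comp (by fun_prop))).trans ?_
    gcongr
    unfold lTwo
    refine le_of_eq ?_
    congr 1
    have h2 := lintegral_sub_left_eq_self (μ := (volume : Measure Plane))
      (fun x => v x ^ (2 : ℝ)) z
    rw [← h2]
    congr with x
    simp [neg_add_eq_sub]
  set c := lTwo volume u * lTwo volume v
  have h2 : lTwo volume ((tile p q).indicator (u ⋆ₗ v)) ≤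
      lTwo volume (fun x => c * (tile p q).indicator 1 x) := by
    refine lTwo_mono fun x => ?_
    by_cases hx : x ∈ tile p q
    · simpa [hx] using h1 x
    · simp [hx]
  refine ne_top_of_le_ne_top ?_ h2
  rw [lTwo_const_mul _ (measurable_one.indicator (measurableSet_tile p q))]
  refine ENNReal.mul_ne_top (ENNReal.mul_ne_top hu2 hv2) ?_
  have h3 : volume (tile p q) ≠ ⊤ := by
    refine ne_top_of_le_ne_top ?_ (volume_le_of_subset_two_boxes (S := tile p q) (z := 0)
      (j := p) (k := q) (l := p) (m := q)
      (fun x hx => abs_zero_le_of_mem_tile hx) (fun x hx => abs_one_le_of_mem_tile hx)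
      (fun x hx => by simpa using abs_zero_le_of_mem_tile hx)
      (fun x hx => by simpa using abs_one_le_of_mem_tile hx))
    exact ENNReal.mul_ne_top (by simp) (ENNReal.mul_ne_top (two_rpow_ne_top _) (two_rpow_ne_top _))
  unfold lTwo
  refine ENNReal.rpow_ne_top_of_nonneg (by norm_num) (ne_top_of_le_ne_top h3 (le_of_eq ?_))
  rw [← lintegral_indicator_one (measurableSet_tile p q)]
  congr with x
  by_cases hx : x ∈ tile p q <;> simp [hx]

/-- Convolution of functions supported in two tiles, localised to a third one: frequency supports
of the first factor and of the output. -/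
lemma lTwo_indicator_lconvolution_le {u v : Plane → ℝ≥0∞} {j k : ℤ} (p q : ℤ) (hu : Measurable u)
    (hv : Measurable v) (hu' : Function.support u ⊆ tile j k)
    (hu2 : lTwo volume u ≠ ⊤) (hv2 : lTwo volume v ≠ ⊤) :
    lTwo volume ((tile p q).indicator (u ⋆ₗ v)) ≤
      4 * (2 ^ (((min j p : ℤ) : ℝ) / 2) * 2 ^ (((min k q : ℤ) : ℝ) / 2)) *
        (lTwo volume u * lTwo volume v) := by
  rw [← sixteen_mul_rpow_half]
  set w := (tile p q).indicator (u ⋆ₗ v) with hw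
  set K : ℝ≥0∞ := 16 * (2 ^ ((min j p : ℤ) : ℝ) * 2 ^ ((min k q : ℤ) : ℝ))
  have hwm : Measurable w := (measurable_lconvolution _ hu hv).indicator (measurableSet_tile p q)
  have hfin : lTwo volume w ≠ ⊤ := lTwo_indicator_lconvolution_ne_top p q hu hv hu2 hv2
  have h1 : lTwo volume (fun y => ∫⁻ x, u x * w (x + y)) ≤
      K ^ (1 / 2 : ℝ) * (lTwo volume u * lTwo volume w) := by
    refine lTwo_lintegral_mul_le (W := fun y x => w (x + y)) hu ?_ (fun y => ?_) (fun x => ?_)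
    · exact hwm.comp (by fun_prop)
    · have hmem : ∀ x ∈ Function.support (fun x => u x * w (x + y)),
          x ∈ tile j k ∧ x + y ∈ tile p q := fun x hx =>
        ⟨hu' (left_ne_zero_of_mul hx), by
          by_contra hc
          exact right_ne_zero_of_mul hx (by simp [hw, hc])⟩
      refine volume_le_of_subset_two_boxes (z := -y)
        (fun x hx => abs_zero_le_of_mem_tile (hmem x hx).1)
        (fun x hx => abs_one_le_of_mem_tile (hmem x hx).1) (fun x hx => ?_) (fun x hx => ?_)
      · simpa using abs_zero_le_of_mem_tile (hmem x hx).2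
      · simpa using abs_one_le_of_mem_tile (hmem x hx).2
    · unfold lTwo
      rw [lintegral_add_left_eq_self (fun z => w z ^ (2 : ℝ)) x]
  -- Duality with w itself as test function: the trilinear form ∫∫ u(x) v(y) w(x+y) is read as v
  -- paired with the correlation of u and w, so that the support of w replaces that of v.
  have h2 : lTwo volume w ^ (2 : ℝ) ≤
      lTwo volume w * (K ^ (1 / 2 : ℝ) * (lTwo volume u * lTwo volume v)) := by
    calc lTwo volume w ^ (2 : ℝ) = ∫⁻ z, w z ^ (2 : ℝ) := lTwo_rpow_two _
      _ ≤ ∫⁻ z, w z * (u ⋆ₗ v) z := by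
          gcongr with z
          rw [ENNReal.rpow_two, sq]
          gcongr
          exact Set.indicator_le_self _ _ _
      _ = ∫⁻ z, ∫⁻ x, w z * (u x * v (-x + z)) := by
          congr with z
          rw [lconvolution_def, lintegral_const_mul]
          exact hu.mul (hv.comp (by fun_prop))
      _ = ∫⁻ x, ∫⁻ z, w z * (u x * v (-x + z)) := by
          refine lintegral_lintegral_swap (Measurable.aemeasurable ?_)
          exact (hwm.comp measurable_fst).mul
            ((hu.comp measurable_snd).mul (hv.comp (by fun_prop)))
      _ = ∫⁻ x, ∫⁻ y, w (x + y) * (u x * v y) := by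
          congr with x
          rw [← lintegral_add_left_eq_self _ x]
          simp
      _ = ∫⁻ y, ∫⁻ x, w (x + y) * (u x * v y) := by
          refine lintegral_lintegral_swap (Measurable.aemeasurable ?_)
          exact (hwm.comp (by fun_prop)).mul
            ((hu.comp measurable_fst).mul (hv.comp measurable_snd))
      _ = ∫⁻ y, v y * ∫⁻ x, u x * w (x + y) := by
          congr with y
          rw [← lintegral_const_mul]
          · congr with x; ring
          · exact hu.mul (hwm.comp (by fun_prop))
      _ ≤ lTwo volume v * lTwo volume (fun y => ∫⁻ x, u x * w (x + y)) := by
          refine lintegral_mul_le_lTwo hv (Measurable.lintegral_prod_right ?_)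
          exact (hu.comp measurable_snd).mul (hwm.comp (by fun_prop))
      _ ≤ lTwo volume v * (K ^ (1 / 2 : ℝ) * (lTwo volume u * lTwo volume w)) := by gcongr
      _ = _ := by ring
  -- One factor ‖w‖ is cancelled, legitimate when it is neither 0 nor ∞.
  by_cases h0 : lTwo volume w = 0
  · simp [h0]
  · rw [ENNReal.rpow_two, sq] at h2
    exact (ENNReal.mul_le_mul_iff_right h0 hfin).1 h2

/-- The gain of a triple of dyadic scales in a trilinear interaction. -/
def gain (j l p : ℤ) : ℝ≥0∞ :=
  if j ≤ max l p + 1 ∧ l ≤ max j p + 1 ∧ p ≤ max j l + 1 then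
    2 ^ (((min j (min l p) : ℤ) : ℝ) / 2) else 0

/-- If j exceeded both indices by 2, then b and c would be below 2^{j-1} and b + c below 2^j. -/
lemma le_max_add_one_of_norm_le {j l p : ℤ} {a b c : ℝ} (ha : 2 ^ j ≤ a) (hb : b < 2 ^ (l + 1))
    (hc : c < 2 ^ (p + 1)) (h : a ≤ b + c) : j ≤ max l p + 1 := by
  by_contra! hcon
  have h1 : (2 : ℝ) ^ (l + 1) ≤ 2 ^ (j - 1) := zpow_le_zpow_right₀ (by norm_num) (by omega)
  have h2 : (2 : ℝ) ^ (p + 1) ≤ 2 ^ (j - 1) := zpow_le_zpow_right₀ (by norm_num) (by omega)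
  have h3 : (2 : ℝ) ^ j = 2 ^ (j - 1) * 2 := by
    rw [← zpow_add_one₀ (by norm_num)]; congr 1; ring
  linarith

lemma triangle_of_mem_tile {j k l m p q : ℤ} {x y : Plane} (hx : x ∈ tile j k)
    (hy : y ∈ tile l m) (hxy : x + y ∈ tile p q) :
    (j ≤ max l p + 1 ∧ l ≤ max j p + 1 ∧ p ≤ max j l + 1) ∧
      (k ≤ max m q + 1 ∧ m ≤ max k q + 1 ∧ q ≤ max k m + 1) := by
  obtain ⟨⟨hx1, hx2⟩, hx3, hx4⟩ := hx
  obtain ⟨⟨hy1, hy2⟩, hy3, hy4⟩ := hy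
  obtain ⟨⟨hz1, hz2⟩, hz3, hz4⟩ := hxy
  rw [smul_add] at hz1 hz2 hz3 hz4
  rw [PiLp.add_apply] at hz3 hz4
  set X := (2 * Real.pi) • x
  set Y := (2 * Real.pi) • y
  refine ⟨⟨?_, ?_, ?_⟩, ?_, ?_, ?_⟩
  · refine le_max_add_one_of_norm_le hx1 hy2 hz2 ?_
    calc ‖X‖ = ‖(X + Y) - Y‖ := by simp
      _ ≤ _ := by rw [add_comm ‖Y‖]; exact norm_sub_le _ _
  · refine le_max_add_one_of_norm_le hy1 hx2 hz2 ?_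
    calc ‖Y‖ = ‖(X + Y) - X‖ := by simp
      _ ≤ _ := by rw [add_comm ‖X‖]; exact norm_sub_le _ _
  · exact le_max_add_one_of_norm_le hz1 hx2 hy2 (norm_add_le _ _)
  · refine le_max_add_one_of_norm_le hx3 hy4 hz4 ?_
    calc |X 0| = |(X 0 + Y 0) - Y 0| := by simp
      _ ≤ _ := by rw [add_comm |Y 0|]; exact abs_sub _ _
  · refine le_max_add_one_of_norm_le hy3 hx4 hz4 ?_
    calc |Y 0| = |(X 0 + Y 0) - X 0| := by simp
      _ ≤ _ := by rw [add_comm |X 0|]; exact abs_sub _ _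
  · exact le_max_add_one_of_norm_le hz3 hx4 hy4 (abs_add_le _ _)

/-- The two minima may belong to different members of the triple (u, v, output), but some pair among
the three contains both, and each pair has its own Cauchy–Schwarz bound. Incompatible scales give
zero by the triangle inequality. -/
lemma lTwo_tile_lconvolution_le {u v : Plane → ℝ≥0∞} {j k l m : ℤ} (p q : ℤ) (hu : Measurable u)
    (hv : Measurable v) (hu' : Function.support u ⊆ tile j k) (hv' : Function.support v ⊆ tile l m)
    (hu2 : lTwo volume u ≠ ⊤) (hv2 : lTwo volume v ≠ ⊤) :
    lTwo volume ((tile p q).indicator (u ⋆ₗ v)) ≤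
      4 * (gain j l p * gain k m q) * (lTwo volume u * lTwo volume v) := by
  by_cases hadm : (j ≤ max l p + 1 ∧ l ≤ max j p + 1 ∧ p ≤ max j l + 1) ∧
      (k ≤ max m q + 1 ∧ m ≤ max k q + 1 ∧ q ≤ max k m + 1)
  · rw [gain, gain, if_pos hadm.1, if_pos hadm.2]
    have h : (min j (min l p) = min j l ∧ min k (min m q) = min k m) ∨
        (min j (min l p) = min j p ∧ min k (min m q) = min k q) ∨
        (min j (min l p) = min l p ∧ min k (min m q) = min m q) := by omega
    rcases h with ⟨h1, h2⟩ | ⟨h1, h2⟩ | ⟨h1, h2⟩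
    · rw [h1, h2]
      exact (lTwo_mono fun x => Set.indicator_le_self _ _ _).trans
        (lTwo_lconvolution_le hu hv hu' hv')
    · rw [h1, h2]
      exact lTwo_indicator_lconvolution_le p q hu hv hu' hu2 hv2
    · rw [h1, h2, lconvolution_comm, mul_comm (lTwo volume u)]
      exact lTwo_indicator_lconvolution_le p q hv hu hv' hv2 hu2
  · have h0 : ∀ z, (tile p q).indicator (u ⋆ₗ v) z = 0 := by
      intro z
      by_cases hz : z ∈ tile p q
      · rw [Set.indicator_of_mem hz, lconvolution_def]
        refine (lintegral_congr fun x => ?_).trans lintegral_zero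
        by_contra hne
        refine hadm (triangle_of_mem_tile (hu' (left_ne_zero_of_mul hne))
          (hv' (right_ne_zero_of_mul hne)) ?_)
        simpa using hz
      · simp [hz]
    rw [lTwo_congr_ae (ae_of_all _ h0), lTwo_zero]
    exact zero_le

end Tiles

/-! ### One-dimensional summation over the output scale. -/

section ScaleSum

lemma tsum_two_rpow_neg_abs_ne_top {δ : ℝ} (hδ : 0 < δ) :
    ∑' p : ℤ, (2 : ℝ≥0∞) ^ (-(δ * |(p : ℝ)|)) ≠ ⊤ := by
  have h1 : ∀ p : ℤ, (2 : ℝ≥0∞) ^ (-(δ * |(p : ℝ)|)) =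
      ENNReal.ofReal ((2 : ℝ) ^ (-(δ * |(p : ℝ)|))) := fun p => by
    rw [← ENNReal.ofReal_rpow_of_pos two_pos]; simp
  simp_rw [h1]
  have hr : (2 : ℝ) ^ (-δ) < 1 := Real.rpow_lt_one_of_one_lt_of_neg (by norm_num) (by linarith)
  have hnat : Summable fun n : ℕ => (2 : ℝ) ^ (-(δ * |(n : ℝ)|)) := by
    refine (summable_geometric_of_lt_one (by positivity) hr).congr fun n => ?_
    rw [← Real.rpow_mul_natCast (by norm_num)]
    simp
  refine Summable.tsum_ofReal_ne_top ?_
  refine Summable.of_nat_of_neg ?_ ?_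
  · simpa using hnat
  · simpa using hnat

/-- If p is within 1 of j, bounding the minimum by l leaves the excess (j - l)(s₂ - 1/2) ≤ 0.
Otherwise l is within 1 of j, and bounding the minimum by p leaves p(s₁ + s₂), which decays as p
falls below j. The constant 3 absorbs the unit shifts, since 0 < s₁ + s₂ ≤ 1 and |s₂| ≤ 1/2. -/
lemma scale_exponent_le {s₁ s₂ : ℝ} (hs₁ : s₁ ≤ 1 / 2) (hs₂ : s₂ ≤ 1 / 2) (hs : 0 < s₁ + s₂)
    {j l p : ℤ} (hlj : l ≤ j) (h1 : j ≤ max l p + 1) (h3 : p ≤ max j l + 1) :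
    (p : ℝ) * (s₁ + s₂ - 1 / 2) + ((min j (min l p) : ℤ) : ℝ) / 2 ≤
      3 + -((s₁ + s₂) * |(p - j : ℝ)|) + (j * s₁ + l * s₂) := by
  have hlj' : (l : ℝ) ≤ j := by exact_mod_cast hlj
  have hp : p ≤ j + 1 := by omega
  rcases (by omega : (j - 1 ≤ p) ∨ (j - 1 ≤ l)) with h | h
  · have hmin : ((min j (min l p) : ℤ) : ℝ) ≤ l := by
      exact_mod_cast (by omega : min j (min l p) ≤ l)
    have hprod : ((j : ℝ) - l) * (s₂ - 1 / 2) ≤ 0 :=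
      mul_nonpos_of_nonneg_of_nonpos (by linarith) (by linarith)
    rcases (by omega : p = j - 1 ∨ p = j ∨ p = j + 1) with rfl | rfl | rfl
    · push_cast at *
      rw [show (j - 1 - j : ℝ) = -1 by ring, abs_neg, abs_one]
      nlinarith
    · rw [sub_self, abs_zero]
      nlinarith
    · push_cast at *
      rw [show (j + 1 - j : ℝ) = 1 by ring, abs_one]
      nlinarith
  · have hmin : ((min j (min l p) : ℤ) : ℝ) ≤ p := by
      exact_mod_cast (by omega : min j (min l p) ≤ p)
    -- The summand 2 covers p = j + 1, where j - p is negative.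
    have habs : (s₁ + s₂) * |(p - j : ℝ)| ≤ (s₁ + s₂) * (j - p + 2) := by
      gcongr
      have : (p : ℝ) ≤ j + 1 := by exact_mod_cast hp
      rw [abs_le]; constructor <;> linarith
    rcases (by omega : l = j - 1 ∨ l = j) with rfl | rfl
    · push_cast at *
      nlinarith
    · nlinarith

lemma gain_comm (j l p : ℤ) : gain j l p = gain l j p := by
  unfold gain
  have h1 : min j (min l p) = min l (min j p) := by omega
  have h2 : (j ≤ max l p + 1 ∧ l ≤ max j p + 1 ∧ p ≤ max j l + 1) ↔
    (l ≤ max j p + 1 ∧ j ≤ max l p + 1 ∧ p ≤ max l j + 1) := by omega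
  rw [h1, if_congr h2 rfl rfl]

lemma tsum_gain_le_of_le {s₁ s₂ : ℝ} (hs₁ : s₁ ≤ 1 / 2) (hs₂ : s₂ ≤ 1 / 2) (hs : 0 < s₁ + s₂)
    {j l : ℤ} (hlj : l ≤ j) :
    ∑' p : ℤ, (2 : ℝ≥0∞) ^ ((p : ℝ) * (s₁ + s₂ - 1 / 2)) * gain j l p ≤
      (8 * ∑' p : ℤ, (2 : ℝ≥0∞) ^ (-((s₁ + s₂) * |(p : ℝ)|))) *
        (2 ^ ((j : ℝ) * s₁) * 2 ^ ((l : ℝ) * s₂)) := by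
  have hterm : ∀ p : ℤ, (2 : ℝ≥0∞) ^ ((p : ℝ) * (s₁ + s₂ - 1 / 2)) * gain j l p ≤
      8 * (2 : ℝ≥0∞) ^ (-((s₁ + s₂) * |((p - j : ℤ) : ℝ)|)) *
        (2 ^ ((j : ℝ) * s₁) * 2 ^ ((l : ℝ) * s₂)) := by
    intro p
    unfold gain
    split_ifs with h
    · rw [← two_rpow_add, ← two_rpow_add,
        show (8 : ℝ≥0∞) = 2 ^ (3 : ℝ) by norm_num, ← two_rpow_add, ← two_rpow_add]
      refine two_rpow_mono ?_
      push_cast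
      exact_mod_cast scale_exponent_le hs₁ hs₂ hs hlj h.1 h.2.2
    · simp
  refine (ENNReal.tsum_le_tsum hterm).trans (le_of_eq ?_)
  rw [ENNReal.tsum_mul_right, ENNReal.tsum_mul_left]
  congr 2
  exact (Equiv.subRight j).tsum_eq fun p : ℤ => (2 : ℝ≥0∞) ^ (-((s₁ + s₂) * |(p : ℝ)|))

/-- The one-dimensional summation over output scales. -/
lemma exists_tsum_gain_le {s₁ s₂ : ℝ} (hs₁ : s₁ ≤ 1 / 2) (hs₂ : s₂ ≤ 1 / 2) (hs : 0 < s₁ + s₂) :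
    ∃ C : ℝ≥0∞, C ≠ ⊤ ∧ ∀ j l : ℤ,
      ∑' p : ℤ, (2 : ℝ≥0∞) ^ ((p : ℝ) * (s₁ + s₂ - 1 / 2)) * gain j l p ≤
        C * (2 ^ ((j : ℝ) * s₁) * 2 ^ ((l : ℝ) * s₂)) := by
  refine ⟨8 * ∑' p : ℤ, (2 : ℝ≥0∞) ^ (-((s₁ + s₂) * |(p : ℝ)|)),
    ENNReal.mul_ne_top (by simp) (tsum_two_rpow_neg_abs_ne_top hs), fun j l => ?_⟩
  rcases le_total l j with h | h
  · exact tsum_gain_le_of_le hs₁ hs₂ hs h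
  · have := tsum_gain_le_of_le hs₂ hs₁ (by linarith : 0 < s₂ + s₁) h
    simp_rw [gain_comm l j, add_comm s₂ s₁] at this
    rwa [mul_comm ((2 : ℝ≥0∞) ^ ((l : ℝ) * s₂))] at this

end ScaleSum

/-! ### The sharp-tile Besov norm and the convolution estimate. -/

section TileNorm

/-- The half-open conditions are those of the integer logarithm, so the tiles partition the plane
off the null line `ξ 0 = 0`. -/
lemma mem_tile_iff {j k : ℤ} {ξ : Plane} (hξ : ξ 0 ≠ 0) :
    ξ ∈ tile j k ↔ (j, k) =
      (Int.log 2 ‖(2 * Real.pi) • ξ‖, Int.log 2 |((2 * Real.pi) • ξ) 0|) := by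
  have key : ∀ {t : ℝ} {n : ℤ}, 0 < t → (((2 : ℝ) ^ n ≤ t ∧ t < 2 ^ (n + 1)) ↔ n = Int.log 2 t) := by
    intro t n ht
    have h1 := Int.zpow_le_iff_le_log (R := ℝ) (b := 2) one_lt_two (x := n) ht
    have h2 := Int.lt_zpow_iff_log_lt (R := ℝ) (b := 2) one_lt_two (x := n + 1) ht
    push_cast at h1 h2
    rw [h1, h2]
    omega
  have h0 : ((2 * Real.pi) • ξ) 0 ≠ 0 := by
    simpa [Real.pi_ne_zero] using hξ
  have hne : (2 * Real.pi) • ξ ≠ 0 := fun h => h0 (by rw [h]; rfl)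
  rw [Prod.mk.injEq, ← key (norm_pos_iff.2 hne), ← key (abs_pos.2 h0)]
  rfl

lemma volume_zero_coord : volume {ξ : Plane | ξ 0 = 0} = 0 := by
  let L : Plane →ₗ[ℝ] ℝ := (EuclideanSpace.proj (0 : Fin 2) : Plane →L[ℝ] ℝ)
  have h := Measure.addHaar_submodule (volume : Measure Plane) (LinearMap.ker L) (by
    intro htop
    have : (EuclideanSpace.single 0 1 : Plane) ∈ LinearMap.ker L := by rw [htop]; trivial
    simp [L] at this)
  convert h using 2
  ext ξ
  simp [L]

lemma ae_zero_coord_ne : ∀ᵐ ξ : Plane, ξ 0 ≠ 0 := by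
  rw [ae_iff]
  simpa using volume_zero_coord

lemma tsum_indicator_tile (U : Plane → ℝ≥0∞) {ξ : Plane} (hξ : ξ 0 ≠ 0) :
    ∑' p : ℤ × ℤ, (tile p.1 p.2).indicator U ξ = U ξ := by
  rw [tsum_eq_single (Int.log 2 ‖(2 * Real.pi) • ξ‖, Int.log 2 |((2 * Real.pi) • ξ) 0|)]
  · exact Set.indicator_of_mem ((mem_tile_iff hξ).2 rfl) _
  · intro p hp
    exact Set.indicator_of_notMem (fun h => hp ((mem_tile_iff hξ).1 h)) _

/-- The discrete Besov norm of a function on the frequency side, with sharp dyadic tiles. -/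
def tileNorm (s τ : ℝ) (U : Plane → ℝ≥0∞) : ℝ≥0∞ :=
  ∑' p : ℤ × ℤ, (2 : ℝ≥0∞) ^ ((p.1 : ℝ) * s) * (2 : ℝ≥0∞) ^ ((p.2 : ℝ) * τ) *
    lTwo volume ((tile p.1 p.2).indicator U)

lemma lTwo_indicator_tile_ne_top {s τ : ℝ} {U : Plane → ℝ≥0∞} (h : tileNorm s τ U ≠ ⊤)
    (p : ℤ × ℤ) : lTwo volume ((tile p.1 p.2).indicator U) ≠ ⊤ := by
  have h1 := ENNReal.ne_top_of_tsum_ne_top h p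
  intro htop
  rw [htop, ENNReal.mul_top] at h1
  · exact h1 rfl
  · exact mul_ne_zero (two_rpow_ne_zero _) (two_rpow_ne_zero _)

lemma lconvolution_eq_tsum {U V : Plane → ℝ≥0∞} (hU : Measurable U) (hV : Measurable V)
    (z : Plane) :
    (U ⋆ₗ V) z = ∑' a : ℤ × ℤ, ∑' b : ℤ × ℤ,
      ((tile a.1 a.2).indicator U ⋆ₗ (tile b.1 b.2).indicator V) z := by
  have hUm : ∀ a : ℤ × ℤ, Measurable ((tile a.1 a.2).indicator U) := fun a =>
    hU.indicator (measurableSet_tile _ _)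
  have hVm : ∀ a : ℤ × ℤ, Measurable ((tile a.1 a.2).indicator V) := fun a =>
    hV.indicator (measurableSet_tile _ _)
  have hVm' : ∀ a : ℤ × ℤ, Measurable fun x => (tile a.1 a.2).indicator V (-x + z) := fun a =>
    (hVm a).comp (by fun_prop)
  have hae : ∀ᵐ x : Plane, (-x + z) 0 ≠ 0 := by
    have h := (quasiMeasurePreserving_sub_left (volume : Measure Plane) z).ae ae_zero_coord_ne
    filter_upwards [h] with x hx
    rwa [neg_add_eq_sub]
  calc (U ⋆ₗ V) z = ∫⁻ x, ∑' a : ℤ × ℤ, ∑' b : ℤ × ℤ,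
        (tile a.1 a.2).indicator U x * (tile b.1 b.2).indicator V (-x + z) := by
        refine lintegral_congr_ae ?_
        filter_upwards [hae, ae_zero_coord_ne] with x hx hx'
        simp_rw [ENNReal.tsum_mul_left, ENNReal.tsum_mul_right, tsum_indicator_tile V hx,
          tsum_indicator_tile U hx']
    _ = _ := by
        have hm : ∀ a b : ℤ × ℤ, Measurable fun x =>
            (tile a.1 a.2).indicator U x * (tile b.1 b.2).indicator V (-x + z) := fun a b =>
          (hUm a).mul (hVm' b)
        have hm' : ∀ a : ℤ × ℤ, Measurable fun x => ∑' b : ℤ × ℤ,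
            (tile a.1 a.2).indicator U x * (tile b.1 b.2).indicator V (-x + z) := fun a =>
          Measurable.tsum fun b => hm a b
        rw [lintegral_tsum fun a => (hm' a).aemeasurable]
        congr with a
        rw [lintegral_tsum fun b => (hm a b).aemeasurable]
        rfl

/-- The product law on the frequency side: convolution of nonnegative functions. -/
theorem exists_tileNorm_lconvolution_le {s₁ s₂ τ₁ τ₂ : ℝ} (hs₁ : s₁ ≤ 1 / 2) (hs₂ : s₂ ≤ 1 / 2)
    (hτ₁ : τ₁ ≤ 1 / 2) (hτ₂ : τ₂ ≤ 1 / 2) (hs : 0 < s₁ + s₂) (hτ : 0 < τ₁ + τ₂) :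
    ∃ C : ℝ≥0∞, C ≠ ⊤ ∧ ∀ U V : Plane → ℝ≥0∞, Measurable U → Measurable V →
      tileNorm s₁ τ₁ U ≠ ⊤ → tileNorm s₂ τ₂ V ≠ ⊤ →
      tileNorm (s₁ + s₂ - 1 / 2) (τ₁ + τ₂ - 1 / 2) (U ⋆ₗ V) ≤
        C * tileNorm s₁ τ₁ U * tileNorm s₂ τ₂ V := by
  obtain ⟨C₁, hC₁, h₁⟩ := exists_tsum_gain_le hs₁ hs₂ hs
  obtain ⟨C₂, hC₂, h₂⟩ := exists_tsum_gain_le hτ₁ hτ₂ hτ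
  refine ⟨4 * C₁ * C₂, ENNReal.mul_ne_top (ENNReal.mul_ne_top (by simp) hC₁) hC₂,
    fun U V hU hV hUf hVf => ?_⟩
  set u : ℤ × ℤ → Plane → ℝ≥0∞ := fun a => (tile a.1 a.2).indicator U
  set v : ℤ × ℤ → Plane → ℝ≥0∞ := fun b => (tile b.1 b.2).indicator V
  have hum : ∀ a, Measurable (u a) := fun a => hU.indicator (measurableSet_tile _ _)
  have hvm : ∀ a, Measurable (v a) := fun a => hV.indicator (measurableSet_tile _ _)
  set X : ℤ × ℤ → ℝ≥0∞ := fun a => lTwo volume (u a)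
  set Y : ℤ × ℤ → ℝ≥0∞ := fun b => lTwo volume (v b)
  have hpq : ∀ p : ℤ × ℤ, lTwo volume ((tile p.1 p.2).indicator (U ⋆ₗ V)) ≤
      ∑' a, ∑' b : ℤ × ℤ, 4 * (gain a.1 b.1 p.1 * gain a.2 b.2 p.2) * (X a * Y b) := by
    intro p
    have hm : ∀ a b, Measurable ((tile p.1 p.2).indicator (u a ⋆ₗ v b)) := fun a b =>
      (measurable_lconvolution _ (hum a) (hvm b)).indicator (measurableSet_tile _ _)
    calc lTwo volume ((tile p.1 p.2).indicator (U ⋆ₗ V))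
        = lTwo volume (fun z => ∑' a, ∑' b, (tile p.1 p.2).indicator (u a ⋆ₗ v b) z) := by
          congr with z
          by_cases hz : z ∈ tile p.1 p.2
          · simp only [Set.indicator_of_mem hz]
            exact lconvolution_eq_tsum hU hV z
          · simp [hz]
      _ ≤ ∑' a, lTwo volume (fun z => ∑' b, (tile p.1 p.2).indicator (u a ⋆ₗ v b) z) :=
          lTwo_tsum_le fun a => Measurable.tsum fun b => hm a b
      _ ≤ ∑' a, ∑' b, lTwo volume ((tile p.1 p.2).indicator (u a ⋆ₗ v b)) :=
          ENNReal.tsum_le_tsum fun a => lTwo_tsum_le fun b => hm a b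
      _ ≤ _ := ENNReal.tsum_le_tsum fun a => ENNReal.tsum_le_tsum fun b =>
          lTwo_tile_lconvolution_le p.1 p.2 (hum a) (hvm b) Set.support_indicator_subset
            Set.support_indicator_subset (lTwo_indicator_tile_ne_top hUf a)
            (lTwo_indicator_tile_ne_top hVf b)
  set f : ℤ → ℝ≥0∞ := fun p => 2 ^ ((p : ℝ) * (s₁ + s₂ - 1 / 2))
  set g : ℤ → ℝ≥0∞ := fun q => 2 ^ ((q : ℝ) * (τ₁ + τ₂ - 1 / 2))
  calc tileNorm (s₁ + s₂ - 1 / 2) (τ₁ + τ₂ - 1 / 2) (U ⋆ₗ V)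
      ≤ ∑' p : ℤ × ℤ, f p.1 * g p.2 *
          ∑' a, ∑' b : ℤ × ℤ, 4 * (gain a.1 b.1 p.1 * gain a.2 b.2 p.2) * (X a * Y b) := by
        refine ENNReal.tsum_le_tsum fun p => ?_
        gcongr
        exact hpq p
    -- Weight and gain are products of an isotropic and a horizontal factor, so the sum over output
    -- tiles splits into two one-dimensional sums.
    _ = ∑' a, ∑' b : ℤ × ℤ, 4 * (X a * Y b) *
          ((∑' p, f p * gain a.1 b.1 p) * ∑' q, g q * gain a.2 b.2 q) := by
        simp_rw [← ENNReal.tsum_mul_left]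
        rw [ENNReal.tsum_comm]
        congr with a
        rw [ENNReal.tsum_comm]
        congr with b
        simp_rw [ENNReal.tsum_prod', ENNReal.tsum_mul_left, ← ENNReal.tsum_mul_right,
          ← ENNReal.tsum_mul_left]
        congr with p
        congr with q
        ring
    _ ≤ ∑' a : ℤ × ℤ, ∑' b : ℤ × ℤ, 4 * (X a * Y b) *
          ((C₁ * (2 ^ ((a.1 : ℝ) * s₁) * 2 ^ ((b.1 : ℝ) * s₂))) *
            (C₂ * (2 ^ ((a.2 : ℝ) * τ₁) * 2 ^ ((b.2 : ℝ) * τ₂)))) := by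
        refine ENNReal.tsum_le_tsum fun a => ENNReal.tsum_le_tsum fun b => ?_
        gcongr
        · exact h₁ _ _
        · exact h₂ _ _
    _ = 4 * C₁ * C₂ * tileNorm s₁ τ₁ U * tileNorm s₂ τ₂ V := by
        unfold tileNorm
        rw [mul_assoc, ← ENNReal.tsum_mul_right, ← ENNReal.tsum_mul_left]
        congr with a
        rw [← ENNReal.tsum_mul_left, ← ENNReal.tsum_mul_left]
        congr with b
        ring

end TileNorm

/-! ### Finite tile norm implies polynomially weighted integrability. -/

section Weight

/-- For j ≤ 0 the right side is at least 1. For j ≥ 0 one has 2^j ≤ 2π|ξ| ≤ 7|ξ|, whence 49 = 7². -/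
lemma weight_le_of_mem_tile {j k : ℤ} {ξ : Plane} (h : ξ ∈ tile j k) {δ : ℝ} (hδ : 0 ≤ δ) {M : ℕ}
    (hM : δ ≤ 2 * M) : ((1 + ‖ξ‖ ^ 2) ^ M)⁻¹ ≤ (49 : ℝ) ^ M * 2 ^ (-((j : ℝ) * δ)) := by
  have hpos : (0 : ℝ) < (1 + ‖ξ‖ ^ 2) ^ M := by positivity
  rw [Real.rpow_neg (by norm_num), ← div_eq_mul_inv, le_div_iff₀ (by positivity),
    inv_mul_le_iff₀ hpos, ← mul_pow]
  have h1 : (1 : ℝ) ≤ ((1 + ‖ξ‖ ^ 2) * 49) ^ M := one_le_pow₀ (by nlinarith [sq_nonneg ‖ξ‖])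
  rcases le_total j 0 with hj | hj
  · refine (Real.rpow_le_one_of_one_le_of_nonpos (by norm_num) ?_).trans h1
    exact mul_nonpos_of_nonpos_of_nonneg (by exact_mod_cast hj) hδ
  · have hj' : (0 : ℝ) ≤ j := by exact_mod_cast hj
    calc (2 : ℝ) ^ ((j : ℝ) * δ) ≤ 2 ^ ((j : ℝ) * ((2 * M : ℕ) : ℝ)) := by
          refine Real.rpow_le_rpow_of_exponent_le (by norm_num) ?_
          push_cast
          gcongr
      _ = (((2 : ℝ) ^ j) ^ 2) ^ M := by
          rw [Real.rpow_mul_natCast (by norm_num), Real.rpow_intCast, pow_mul]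
      _ ≤ ((1 + ‖ξ‖ ^ 2) * 49) ^ M := by
          gcongr
          have h2 : (2 : ℝ) ^ j ≤ 7 * ‖ξ‖ := by
            refine h.1.1.trans ?_
            rw [norm_smul, Real.norm_of_nonneg Real.two_pi_pos.le]
            gcongr
            linarith [Real.pi_lt_d2]
          calc ((2 : ℝ) ^ j) ^ 2 ≤ (7 * ‖ξ‖) ^ 2 := by gcongr
            _ ≤ _ := by nlinarith

lemma le_of_mem_tile {j k : ℤ} {ξ : Plane} (h : ξ ∈ tile j k) : k ≤ j := by
  have h2 := PiLp.norm_apply_le ((2 * Real.pi) • ξ) 0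
  rw [Real.norm_eq_abs] at h2
  have h3 : (2 : ℝ) ^ k < 2 ^ (j + 1) := h.2.1.trans_lt (h2.trans_lt h.1.2)
  have := (zpow_lt_zpow_iff_right₀ (by norm_num : (1 : ℝ) < 2)).1 h3
  omega

/-- A function of finite Besov norm is integrable against a negative power of the bracket. -/
lemma exists_lintegral_mul_weight_ne_top {s τ : ℝ} (hs : s ≤ 1 / 2) (hτ : τ ≤ 1 / 2)
    {U : Plane → ℝ≥0∞} (hU : Measurable U) (hUf : tileNorm s τ U ≠ ⊤) :
    ∃ M : ℕ, ∫⁻ ξ, U ξ * ENNReal.ofReal ((1 + ‖ξ‖ ^ 2) ^ M)⁻¹ ≠ ⊤ := by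
  -- Cauchy–Schwarz on a tile loses 2^{(j+k)/2}. Against 2^{js+kτ} the excess is j(1/2 - s) + k(1/2
  -- - τ) ≤ jδ, because k ≤ j on nonempty tiles and τ ≤ 1/2.
  set δ : ℝ := 1 - s - τ with hδ
  obtain ⟨M, hM⟩ := exists_nat_ge (δ / 2)
  refine ⟨M, ?_⟩
  set w : Plane → ℝ≥0∞ := fun ξ => ENNReal.ofReal ((1 + ‖ξ‖ ^ 2) ^ M)⁻¹
  have hw : Measurable w := by
    have : Continuous fun ξ : Plane => ((1 + ‖ξ‖ ^ 2) ^ M)⁻¹ :=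
      Continuous.inv₀ (by fun_prop) fun ξ => by positivity
    exact this.measurable.ennreal_ofReal
  have hUm : ∀ p : ℤ × ℤ, Measurable ((tile p.1 p.2).indicator U) := fun a =>
    hU.indicator (measurableSet_tile _ _)
  have hterm : ∀ p : ℤ × ℤ, ∫⁻ ξ, (tile p.1 p.2).indicator U ξ * w ξ ≤
      (4 * 49 ^ M) * (2 ^ ((p.1 : ℝ) * s) * 2 ^ ((p.2 : ℝ) * τ) *
        lTwo volume ((tile p.1 p.2).indicator U)) := by
    rintro ⟨j, k⟩
    dsimp only
    by_cases hne : (tile j k).Nonempty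
    · obtain ⟨ξ₀, hξ₀⟩ := hne
      have hkj : (k : ℝ) ≤ j := by exact_mod_cast le_of_mem_tile hξ₀
      calc ∫⁻ ξ, (tile j k).indicator U ξ * w ξ
          ≤ ∫⁻ ξ, (49 ^ M * 2 ^ (-((j : ℝ) * δ))) * (tile j k).indicator U ξ := by
            refine lintegral_mono fun ξ => ?_
            dsimp only
            by_cases hξ : ξ ∈ tile j k
            · rw [mul_comm]
              gcongr
              refine (ENNReal.ofReal_le_ofReal (weight_le_of_mem_tile hξ (δ := δ)
                (by linarith) (by linarith))).trans (le_of_eq ?_)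
              rw [ENNReal.ofReal_mul (by positivity), ENNReal.ofReal_pow (by norm_num),
                ← ENNReal.ofReal_rpow_of_pos two_pos]
              simp
            · simp [hξ]
        _ = (49 ^ M * 2 ^ (-((j : ℝ) * δ))) * ∫⁻ ξ, (tile j k).indicator U ξ :=
            lintegral_const_mul _ (hUm (j, k))
        _ ≤ (49 ^ M * 2 ^ (-((j : ℝ) * δ))) * ((4 * (2 ^ ((j : ℝ) / 2) * 2 ^ ((k : ℝ) / 2))) *
              lTwo volume ((tile j k).indicator U)) := by
            gcongr
            rw [← sixteen_mul_rpow_half]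
            refine lintegral_le_measure_support_mul_lTwo (hUm (j, k)) ?_
            refine (measure_mono (Set.support_indicator_subset)).trans ?_
            simpa using volume_le_of_subset_two_boxes (S := tile j k) (z := 0)
              (j := j) (k := k) (l := j) (m := k)
              (fun x hx => abs_zero_le_of_mem_tile hx) (fun x hx => abs_one_le_of_mem_tile hx)
              (fun x hx => by simpa using abs_zero_le_of_mem_tile hx)
              (fun x hx => by simpa using abs_one_le_of_mem_tile hx)
        _ = (4 * 49 ^ M) * ((2 ^ (-((j : ℝ) * δ)) * (2 ^ ((j : ℝ) / 2) * 2 ^ ((k : ℝ) / 2))) *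
              lTwo volume ((tile j k).indicator U)) := by ring
        _ ≤ _ := by
            refine mul_le_mul' le_rfl (mul_le_mul' ?_ le_rfl)
            rw [← two_rpow_add, ← two_rpow_add, ← two_rpow_add]
            refine two_rpow_mono ?_
            rw [hδ]
            nlinarith [mul_nonneg (sub_nonneg.2 hkj) (sub_nonneg.2 hτ)]
    · rw [Set.not_nonempty_iff_eq_empty.1 hne]
      simp
  have hle : ∫⁻ ξ, U ξ * w ξ ≤ (4 * 49 ^ M) * tileNorm s τ U := by
    calc ∫⁻ ξ, U ξ * w ξ = ∫⁻ ξ, ∑' p : ℤ × ℤ, (tile p.1 p.2).indicator U ξ * w ξ := by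
          refine lintegral_congr_ae ?_
          filter_upwards [ae_zero_coord_ne] with ξ hξ
          rw [ENNReal.tsum_mul_right, tsum_indicator_tile U hξ]
      _ = ∑' p : ℤ × ℤ, ∫⁻ ξ, (tile p.1 p.2).indicator U ξ * w ξ :=
          lintegral_tsum fun p => ((hUm p).mul hw).aemeasurable
      _ ≤ _ := by
          unfold tileNorm
          rw [← ENNReal.tsum_mul_left]
          exact ENNReal.tsum_le_tsum hterm
  refine ne_top_of_le_ne_top (ENNReal.mul_ne_top ?_ hUf) hle
  exact ENNReal.mul_ne_top (by simp) (ENNReal.pow_ne_top (by simp))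

end Weight

/-! ### Smoothness and dyadic localisation of the symbols. -/

section Profiles

/-- A smooth profile on `[0, ∞)` that is constant near the origin and vanishes for `t > 8/3`. -/
structure IsRadialProfile (ψ : ℝ → ℝ) : Prop where
  smooth : ContDiff ℝ ∞ ψ
  const_near_zero : ∃ c, ∀ t, 0 ≤ t → t < 3 / 4 → ψ t = c
  vanish : ∀ t, 8 / 3 < t → ψ t = 0

variable {φ χ ψ : ℝ → ℝ}

lemma IsDyadicPartition.ring_eq_zero (h : IsDyadicPartition φ χ) {t : ℝ}
    (ht : t < 3 / 4 ∨ 8 / 3 < t) : φ t = 0 := by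
  by_contra hne
  have := h.support_ring hne
  rcases ht with ht | ht
  · exact absurd this.1 (not_le.2 ht)
  · exact absurd this.2 (not_le.2 ht)

lemma IsDyadicPartition.ball_eq_zero (h : IsDyadicPartition φ χ) {t : ℝ}
    (ht : 4 / 3 < t) : χ t = 0 := by
  by_contra hne
  exact absurd (h.support_ball hne) (not_le.2 ht)

lemma IsDyadicPartition.ball_eq_one (h : IsDyadicPartition φ χ) {t : ℝ} (ht : 0 ≤ t)
    (ht' : t < 3 / 4) : χ t = 1 := by
  have h0 : ∀ j : ℕ, φ ((2 : ℝ) ^ (-(j : ℤ)) * t) = 0 := fun j => by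
    refine h.ring_eq_zero (Or.inl (lt_of_le_of_lt ?_ ht'))
    refine mul_le_of_le_one_left ht (zpow_le_one_of_nonpos₀ (by norm_num) (by simp))
  have h1 := h.sum_inhomogeneous t ht
  simp_rw [h0] at h1
  linarith [h1.unique hasSum_zero]

lemma IsDyadicPartition.isRadialProfile_ring (h : IsDyadicPartition φ χ) : IsRadialProfile φ :=
  ⟨h.smooth_ring, ⟨0, fun _ _ ht => h.ring_eq_zero (Or.inl ht)⟩,
    fun _ ht => h.ring_eq_zero (Or.inr ht)⟩

lemma IsDyadicPartition.isRadialProfile_ball (h : IsDyadicPartition φ χ) : IsRadialProfile χ :=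
  ⟨h.smooth_ball, ⟨1, fun _ ht ht' => h.ball_eq_one ht ht'⟩,
    fun _ ht => h.ball_eq_zero (by linarith)⟩

lemma IsRadialProfile.exists_bound (h : IsRadialProfile ψ) :
    ∃ M : ℝ, 0 ≤ M ∧ ∀ t, 0 ≤ t → |ψ t| ≤ M := by
  obtain ⟨M, hM⟩ := (isCompact_Icc (a := (0 : ℝ)) (b := 8 / 3)).exists_bound_of_continuousOn
    h.smooth.continuous.continuousOn
  refine ⟨max M 0, le_max_right _ _, fun t ht => ?_⟩
  rcases le_or_gt t (8 / 3) with ht' | ht'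
  · exact (hM t ⟨ht, ht'⟩).trans (le_max_left _ _)
  · rw [h.vanish t ht']; simp

/-- Constancy near 0 removes the singularity of the norm at the origin; compact support does the
rest. -/
lemma IsRadialProfile.hasTemperateGrowth_norm {E : Type*} [NormedAddCommGroup E]
    [InnerProductSpace ℝ E] [FiniteDimensional ℝ E] (h : IsRadialProfile ψ) {c : ℝ} (hc : 0 < c) :
    (fun x : E => ψ (c * ‖x‖)).HasTemperateGrowth := by
  refine HasCompactSupport.hasTemperateGrowth ?_ ?_
  · refine HasCompactSupport.intro (isCompact_closedBall (0 : E) (8 / 3 / c)) fun x hx => ?_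
    refine h.vanish _ ?_
    rw [mem_closedBall_zero_iff, not_le, div_lt_iff₀ hc] at hx
    linarith
  · rw [contDiff_iff_contDiffAt]
    intro x
    by_cases hx : x = 0
    · obtain ⟨a, ha⟩ := h.const_near_zero
      subst hx
      have : (fun x : E => ψ (c * ‖x‖)) =ᶠ[𝓝 0] fun _ => a := by
        have hlt : ∀ᶠ x : E in 𝓝 0, c * ‖x‖ < 3 / 4 := by
          refine ContinuousAt.eventually_lt (by fun_prop) continuousAt_const ?_
          simp
        filter_upwards [hlt] with x hx
        exact ha _ (by positivity) hx
      exact contDiffAt_const.congr_of_eventuallyEq this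
    · exact h.smooth.contDiffAt.comp x (contDiffAt_const.mul (contDiffAt_norm ℝ hx))

/-- The isotropic symbol, in the frequency variable of Mathlib's Fourier transform. -/
def isoSymbol (ψ : ℝ → ℝ) (j : ℤ) (ξ : Plane) : ℝ := ψ ((2 : ℝ) ^ (-j) * ‖(2 * Real.pi) • ξ‖)

/-- The horizontal symbol, in the frequency variable of Mathlib's Fourier transform. -/
def horSymbol (ψ : ℝ → ℝ) (k : ℤ) (ξ : Plane) : ℝ :=
  ψ ((2 : ℝ) ^ (-k) * |((2 * Real.pi) • ξ) 0|)

lemma IsRadialProfile.hasTemperateGrowth_isoSymbol (h : IsRadialProfile ψ) (j : ℤ) :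
    (isoSymbol ψ j).HasTemperateGrowth := by
  have h1 := h.hasTemperateGrowth_norm (E := Plane) (c := (2 : ℝ) ^ (-j)) (by positivity)
  exact h1.comp ((2 * Real.pi) • ContinuousLinearMap.id ℝ Plane).hasTemperateGrowth

/-- This symbol need not have compact support in the plane; it is a compactly supported function on
ℝ composed with a linear form. -/
lemma IsRadialProfile.hasTemperateGrowth_horSymbol (h : IsRadialProfile ψ) (k : ℤ) :
    (horSymbol ψ k).HasTemperateGrowth := by
  have h1 := h.hasTemperateGrowth_norm (E := ℝ) (c := (2 : ℝ) ^ (-k)) (by positivity)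
  exact h1.comp ((2 * Real.pi) • (EuclideanSpace.proj (0 : Fin 2) : Plane →L[ℝ] ℝ)).hasTemperateGrowth

/-- Two or more steps away from the logarithm, 2^{-j} t is at least 4 or below 1/2, outside [3/4,
8/3]. -/
lemma IsDyadicPartition.ring_dyadic_eq_zero (h : IsDyadicPartition φ χ) {t : ℝ} (ht : 0 < t)
    {j : ℤ} (hj : j < Int.log 2 t - 1 ∨ Int.log 2 t + 1 < j) : φ ((2 : ℝ) ^ (-j) * t) = 0 := by
  have h1 := Int.zpow_log_le_self (R := ℝ) one_lt_two ht
  have h2 := Int.lt_zpow_succ_log_self (R := ℝ) one_lt_two t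
  push_cast at h1 h2
  have hj0 : (0 : ℝ) < 2 ^ (-j) := by positivity
  have hjj : (2 : ℝ) ^ (-j) * 2 ^ j = 1 := by rw [← zpow_add₀ (by norm_num)]; simp
  refine h.ring_eq_zero ?_
  rcases hj with hj | hj
  · right
    have h3 : (2 : ℝ) ^ (j + 2) ≤ 2 ^ (Int.log 2 t) := zpow_le_zpow_right₀ (by norm_num) (by omega)
    rw [zpow_add₀ (by norm_num)] at h3
    have h4 : (2 : ℝ) ^ (-j) * (2 ^ j * 2 ^ (2 : ℤ)) ≤ 2 ^ (-j) * t := by gcongr; linarith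
    rw [← mul_assoc, hjj] at h4
    norm_num at h4
    rw [zpow_neg]
    linarith
  · left
    have h3 : (2 : ℝ) ^ (Int.log 2 t + 1) ≤ 2 ^ (j - 1) :=
      zpow_le_zpow_right₀ (by norm_num) (by omega)
    rw [zpow_sub_one₀ (by norm_num)] at h3
    have h4 : (2 : ℝ) ^ (-j) * t ≤ 2 ^ (-j) * (2 ^ j * 2⁻¹) := by gcongr; linarith
    rw [← mul_assoc, hjj] at h4
    norm_num at h4
    rw [zpow_neg]
    linarith

lemma IsDyadicPartition.sum_ring_eq_one (h : IsDyadicPartition φ χ) {t : ℝ} (ht : 0 < t)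
    {s : Finset ℤ} (hs : Finset.Icc (Int.log 2 t - 1) (Int.log 2 t + 1) ⊆ s) :
    ∑ j ∈ s, φ ((2 : ℝ) ^ (-j) * t) = 1 := by
  refine (hasSum_sum_of_ne_finset_zero fun j hj => ?_).unique (h.sum_homogeneous t ht)
  refine h.ring_dyadic_eq_zero ht ?_
  by_contra! hcon
  exact hj (hs (Finset.mem_Icc.2 hcon))

lemma abs_coord_pos {ξ : Plane} (hξ : ξ 0 ≠ 0) : 0 < |((2 * Real.pi) • ξ) 0| := by
  have h0 : ((2 * Real.pi) • ξ) 0 ≠ 0 := by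
    simpa [Real.pi_ne_zero] using hξ
  exact abs_pos.2 h0

lemma norm_two_pi_pos {ξ : Plane} (hξ : ξ 0 ≠ 0) : 0 < ‖(2 * Real.pi) • ξ‖ :=
  (abs_coord_pos hξ).trans_le (PiLp.norm_apply_le ((2 * Real.pi) • ξ) 0)

end Profiles

/-! ### Equivalence of the smooth and the sharp dyadic norms. -/

section NormComparison

/-- The displacements between neighbouring dyadic indices. -/
def neighbours : Finset (ℤ × ℤ) := Finset.Icc (-1) 1 ×ˢ Finset.Icc (-1) 1

/-- The weight `2^{js} 2^{kτ}`. -/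
def dyadicWeight (s τ : ℝ) (p : ℤ × ℤ) : ℝ≥0∞ :=
  (2 : ℝ≥0∞) ^ ((p.1 : ℝ) * s) * (2 : ℝ≥0∞) ^ ((p.2 : ℝ) * τ)

lemma dyadicWeight_add (s τ : ℝ) (p e : ℤ × ℤ) :
    dyadicWeight s τ p = dyadicWeight s τ (-e) * dyadicWeight s τ (p + e) := by
  unfold dyadicWeight
  rw [mul_mul_mul_comm, ← two_rpow_add (((-e).1 : ℝ) * s), ← two_rpow_add (((-e).2 : ℝ) * τ)]
  congr 2 <;> · simp only [Prod.fst_neg, Prod.snd_neg, Prod.fst_add, Prod.snd_add]; push_cast; ring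

lemma dyadicWeight_ne_top (s τ : ℝ) (p : ℤ × ℤ) : dyadicWeight s τ p ≠ ⊤ :=
  ENNReal.mul_ne_top (two_rpow_ne_top _) (two_rpow_ne_top _)

lemma dyadicWeight_ne_zero (s τ : ℝ) (p : ℤ × ℤ) : dyadicWeight s τ p ≠ 0 :=
  mul_ne_zero (two_rpow_ne_zero _) (two_rpow_ne_zero _)

/-- Serves both comparisons: a shift to one of the nine neighbours changes the weight by a fixed
factor, and the shifted sum is reindexed. -/
lemma tsum_dyadicWeight_mul_le (s τ : ℝ) (M : ℝ≥0∞) {A B : ℤ × ℤ → Plane → ℝ≥0∞}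
    (hB : ∀ p, Measurable (B p))
    (hAB : ∀ p, ∀ᵐ ξ, A p ξ ≤ M * ∑ e ∈ neighbours, B (p + e) ξ) :
    ∑' p, dyadicWeight s τ p * lTwo volume (A p) ≤
      (M * ∑ e ∈ neighbours, dyadicWeight s τ (-e)) *
        ∑' p, dyadicWeight s τ p * lTwo volume (B p) := by
  calc ∑' p, dyadicWeight s τ p * lTwo volume (A p)
      ≤ ∑' p, ∑ e ∈ neighbours, M * dyadicWeight s τ (-e) *
          (dyadicWeight s τ (p + e) * lTwo volume (B (p + e))) := by
        refine ENNReal.tsum_le_tsum fun p => ?_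
        calc dyadicWeight s τ p * lTwo volume (A p)
            ≤ dyadicWeight s τ p * (M * ∑ e ∈ neighbours, lTwo volume (B (p + e))) := by
              gcongr
              refine (lTwo_mono_ae (hAB p)).trans ?_
              rw [lTwo_const_mul _ (Finset.measurable_sum _ fun e _ => hB (p + e))]
              gcongr
              exact lTwo_sum_le _ fun e => hB (p + e)
          _ = _ := by
              rw [Finset.mul_sum, Finset.mul_sum]
              refine Finset.sum_congr rfl fun e _ => ?_
              rw [dyadicWeight_add s τ p e]
              ring
    _ = ∑ e ∈ neighbours, ∑' p, M * dyadicWeight s τ (-e) *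
          (dyadicWeight s τ (p + e) * lTwo volume (B (p + e))) :=
        Summable.tsum_finsetSum fun _ _ => ENNReal.summable
    _ = _ := by
        rw [Finset.mul_sum, Finset.sum_mul]
        refine Finset.sum_congr rfl fun e _ => ?_
        rw [ENNReal.tsum_mul_left]
        congr 1
        exact (Equiv.addRight e).tsum_eq fun p => dyadicWeight s τ p * lTwo volume (B p)

variable {φ χ : ℝ → ℝ}

/-- The symbol of `Δ_j Δ_k^h`. -/
def blockSymbol (φ : ℝ → ℝ) (p : ℤ × ℤ) (ξ : Plane) : ℝ := isoSymbol φ p.1 ξ * horSymbol φ p.2 ξ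

/-- The discrete Besov norm of a function on the frequency side, with the smooth partition. -/
def freqNorm (φ : ℝ → ℝ) (s τ : ℝ) (U : Plane → ℝ≥0∞) : ℝ≥0∞ :=
  ∑' p : ℤ × ℤ, dyadicWeight s τ p * lTwo volume (fun ξ => ‖blockSymbol φ p ξ‖ₑ * U ξ)

lemma IsDyadicPartition.hasTemperateGrowth_blockSymbol (h : IsDyadicPartition φ χ) (p : ℤ × ℤ) :
    (blockSymbol φ p).HasTemperateGrowth :=
  (h.isRadialProfile_ring.hasTemperateGrowth_isoSymbol p.1).mul
    (h.isRadialProfile_ring.hasTemperateGrowth_horSymbol p.2)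

lemma IsDyadicPartition.measurable_blockSymbol (h : IsDyadicPartition φ χ) (p : ℤ × ℤ) :
    Measurable (blockSymbol φ p) :=
  (h.hasTemperateGrowth_blockSymbol p).1.continuous.measurable

lemma IsDyadicPartition.sum_neighbours_blockSymbol (h : IsDyadicPartition φ χ) {p : ℤ × ℤ}
    {ξ : Plane} (hξ : ξ 0 ≠ 0) (hp : ξ ∈ tile p.1 p.2) :
    ∑ e ∈ neighbours, blockSymbol φ (p + e) ξ = 1 := by
  have hp' := (mem_tile_iff hξ).1 hp
  rw [Prod.mk.injEq] at hp'
  have key : ∀ {t : ℝ} {n : ℤ}, 0 < t → n = Int.log 2 t →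
      ∑ e ∈ Finset.Icc (-1 : ℤ) 1, φ ((2 : ℝ) ^ (-(n + e)) * t) = 1 := by
    intro t n ht hn
    rw [← h.sum_ring_eq_one ht (s := (Finset.Icc (-1 : ℤ) 1).map (addLeftEmbedding n)) ?_,
      Finset.sum_map]
    · rfl
    · intro j hj
      rw [Finset.mem_Icc] at hj
      simp only [Finset.mem_map, Finset.mem_Icc, addLeftEmbedding_apply]
      exact ⟨j - n, by omega, by omega⟩
  unfold neighbours blockSymbol
  rw [Finset.sum_product]
  simp only [Prod.fst_add, Prod.snd_add]
  simp_rw [← Finset.mul_sum, ← Finset.sum_mul]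
  unfold isoSymbol horSymbol
  rw [key (norm_two_pi_pos hξ) hp'.1, key (abs_coord_pos hξ) hp'.2, one_mul]

lemma IsDyadicPartition.exists_tileNorm_le (h : IsDyadicPartition φ χ) (s τ : ℝ) :
    ∃ C : ℝ≥0∞, C ≠ ⊤ ∧ ∀ U : Plane → ℝ≥0∞, Measurable U →
      tileNorm s τ U ≤ C * freqNorm φ s τ U := by
  refine ⟨1 * ∑ e ∈ neighbours, dyadicWeight s τ (-e), ENNReal.mul_ne_top (by simp)
    (ENNReal.sum_ne_top.2 fun e _ => dyadicWeight_ne_top s τ _), fun U hU => ?_⟩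
  refine tsum_dyadicWeight_mul_le s τ 1 (A := fun p => (tile p.1 p.2).indicator U)
    (B := fun p ξ => ‖blockSymbol φ p ξ‖ₑ * U ξ)
    (fun p => (h.measurable_blockSymbol p).enorm.mul hU) (fun p => ?_)
  filter_upwards [ae_zero_coord_ne] with ξ hξ
  by_cases hp : ξ ∈ tile p.1 p.2
  · rw [Set.indicator_of_mem hp, one_mul, ← Finset.sum_mul]
    refine le_mul_of_one_le_left zero_le ?_
    calc (1 : ℝ≥0∞) = ‖∑ e ∈ neighbours, blockSymbol φ (p + e) ξ‖ₑ := by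
          rw [h.sum_neighbours_blockSymbol hξ hp]; simp
      _ ≤ _ := enorm_sum_le _ _
  · simp [hp]

lemma IsDyadicPartition.exists_freqNorm_le (h : IsDyadicPartition φ χ) (s τ : ℝ) :
    ∃ C : ℝ≥0∞, C ≠ ⊤ ∧ ∀ U : Plane → ℝ≥0∞, Measurable U →
      freqNorm φ s τ U ≤ C * tileNorm s τ U := by
  obtain ⟨M, hM0, hM⟩ := h.isRadialProfile_ring.exists_bound
  refine ⟨ENNReal.ofReal (M * M) * ∑ e ∈ neighbours, dyadicWeight s τ (-e),
    ENNReal.mul_ne_top (by simp)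
    (ENNReal.sum_ne_top.2 fun e _ => dyadicWeight_ne_top s τ _), fun U hU => ?_⟩
  refine tsum_dyadicWeight_mul_le s τ _ (B := fun p => (tile p.1 p.2).indicator U)
    (A := fun p ξ => ‖blockSymbol φ p ξ‖ₑ * U ξ)
    (fun p => hU.indicator (measurableSet_tile _ _)) (fun p => ?_)
  filter_upwards [ae_zero_coord_ne] with ξ hξ
  by_cases hb : blockSymbol φ p ξ = 0
  · simp [hb]
  · have hle : ‖blockSymbol φ p ξ‖ₑ ≤ ENNReal.ofReal (M * M) := by
      rw [← ofReal_norm, Real.norm_eq_abs]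
      refine ENNReal.ofReal_le_ofReal ?_
      unfold blockSymbol isoSymbol horSymbol
      rw [abs_mul]
      gcongr
      · exact hM _ (by positivity)
      · exact hM _ (by positivity)
    gcongr
    have h1 : ∀ {t : ℝ} {n : ℤ}, 0 < t → φ ((2 : ℝ) ^ (-n) * t) ≠ 0 →
        -1 ≤ Int.log 2 t - n ∧ Int.log 2 t - n ≤ 1 := by
      intro t n ht hne
      by_contra hcon
      exact hne (h.ring_dyadic_eq_zero ht (by omega))
    have hj := h1 (norm_two_pi_pos hξ) (left_ne_zero_of_mul hb)
    have hk := h1 (abs_coord_pos hξ) (right_ne_zero_of_mul hb)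
    set P : ℤ × ℤ := (Int.log 2 ‖(2 * Real.pi) • ξ‖, Int.log 2 |((2 * Real.pi) • ξ) 0|) with hP
    have hmem : P - p ∈ neighbours := by
      simp only [neighbours, Finset.mem_product, Finset.mem_Icc]
      exact ⟨hj, hk⟩
    refine le_trans ?_ (Finset.single_le_sum (fun _ _ => zero_le) hmem)
    rw [show p + (P - p) = P by abel, Set.indicator_of_mem ((mem_tile_iff hξ).2 rfl)]

end NormComparison

open FourierTransform

/-! ### Functions of tempered growth as distributions. -/

section Tempered

/-- Faster decay than any power of the bracket. -/
def RapidDecay (g : Plane → ℂ) : Prop :=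
  ∀ M : ℕ, ∃ C : ℝ, ∀ ξ, ‖g ξ‖ ≤ C * ((1 + ‖ξ‖ ^ 2) ^ M)⁻¹

/-- Measurable functions integrable against some negative power of the bracket. -/
def IsTempered (F : Plane → ℂ) : Prop :=
  Measurable F ∧ ∃ M : ℕ, Integrable fun ξ => ((1 + ‖ξ‖ ^ 2) ^ M)⁻¹ * ‖F ξ‖

lemma hasTemperateGrowth_bracket (M : ℕ) :
    (fun ξ : Plane => (1 + ‖ξ‖ ^ 2) ^ M).HasTemperateGrowth := by
  have h := (Function.HasTemperateGrowth.const (1 : ℝ)).add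
    (Function.hasTemperateGrowth_norm_sq Plane)
  exact h.pow M

lemma rapidDecay_schwartz (ψ : 𝓢(Plane, ℂ)) : RapidDecay ψ := by
  intro M
  have h := hasTemperateGrowth_bracket M
  set θ := SchwartzMap.smulLeftCLM ℂ (fun ξ : Plane => (1 + ‖ξ‖ ^ 2) ^ M) ψ with hθ
  refine ⟨SchwartzMap.seminorm ℝ 0 0 θ, fun ξ => ?_⟩
  have h1 := SchwartzMap.norm_le_seminorm ℝ θ ξ
  rw [hθ, SchwartzMap.smulLeftCLM_apply_apply h, norm_smul,
    Real.norm_of_nonneg (by positivity)] at h1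
  rwa [← div_eq_mul_inv, le_div_iff₀ (by positivity), mul_comm]

lemma rapidDecay_of_bounded_support {g : Plane → ℂ} {B R : ℝ} (hB : ∀ ξ, ‖ξ‖ ≤ R → ‖g ξ‖ ≤ B)
    (hR : ∀ ξ, R < ‖ξ‖ → g ξ = 0) : RapidDecay g := by
  intro M
  refine ⟨max B 0 * (1 + R ^ 2) ^ M, fun ξ => ?_⟩
  rcases le_or_gt ‖ξ‖ R with h | h
  · rw [← div_eq_mul_inv, le_div_iff₀ (by positivity)]
    have h0 : ‖g ξ‖ ≤ max B 0 := (hB ξ h).trans (le_max_left _ _)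
    gcongr
  · rw [hR ξ h, norm_zero]
    positivity

lemma IsTempered.integrable_mul {F g : Plane → ℂ} (hF : IsTempered F) (hg : Measurable g)
    (hd : RapidDecay g) : Integrable fun ξ => g ξ * F ξ := by
  obtain ⟨hFm, M, hM⟩ := hF
  obtain ⟨C, hC⟩ := hd M
  refine (hM.const_mul C).mono' (hg.mul hFm).aestronglyMeasurable (ae_of_all _ fun ξ => ?_)
  rw [norm_mul, ← mul_assoc]
  gcongr
  exact hC ξ

lemma isTempered_of_lintegral {F : Plane → ℂ} (hF : Measurable F) {U : Plane → ℝ≥0∞}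
    (hFU : ∀ ξ, ‖F ξ‖ₑ ≤ U ξ) {M : ℕ}
    (hM : ∫⁻ ξ, U ξ * ENNReal.ofReal ((1 + ‖ξ‖ ^ 2) ^ M)⁻¹ ≠ ⊤) : IsTempered F := by
  have hc : Continuous fun ξ : Plane => ((1 + ‖ξ‖ ^ 2) ^ M)⁻¹ :=
    Continuous.inv₀ (by fun_prop) fun ξ => by positivity
  refine ⟨hF, M, (hc.measurable.mul hF.norm).aestronglyMeasurable, ?_⟩
  refine lt_of_le_of_lt (lintegral_mono fun ξ => ?_) (lt_top_iff_ne_top.2 hM)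
  rw [enorm_mul, mul_comm, enorm_norm, Real.enorm_of_nonneg (by positivity)]
  gcongr
  exact hFU ξ

lemma isTempered_of_tileNorm {s τ : ℝ} (hs : s ≤ 1 / 2) (hτ : τ ≤ 1 / 2) {F : Plane → ℂ}
    (hF : Measurable F) {U : Plane → ℝ≥0∞} (hU : Measurable U) (hFU : ∀ ξ, ‖F ξ‖ₑ ≤ U ξ)
    (h : tileNorm s τ U ≠ ⊤) : IsTempered F := by
  obtain ⟨M, hM⟩ := exists_lintegral_mul_weight_ne_top hs hτ hU h
  exact isTempered_of_lintegral hF hFU hM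

/-- A tempered function defines a tempered distribution. -/
lemma IsTempered.exists_distribution {F : Plane → ℂ} (hF : IsTempered F) :
    ∃ T : 𝓢'(Plane, ℂ), ∀ ψ : 𝓢(Plane, ℂ), T ψ = ∫ ξ, ψ ξ * F ξ := by
  obtain ⟨hFm, M, hM⟩ := hF
  have hc : Continuous fun ξ : Plane => ((1 + ‖ξ‖ ^ 2) ^ M)⁻¹ :=
    Continuous.inv₀ (by fun_prop) fun ξ => by positivity
  have hcC : Measurable fun ξ : Plane => (((((1 + ‖ξ‖ ^ 2) ^ M)⁻¹ : ℝ)) : ℂ) :=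
    (Complex.continuous_ofReal.comp hc).measurable
  -- Divided by the bracket, F is in L¹ and defines a distribution; multiplication by the bracket,
  -- which has temperate growth, restores F.
  set F' : Plane → ℂ := fun ξ => ((((1 + ‖ξ‖ ^ 2) ^ M)⁻¹ : ℝ) : ℂ) * F ξ
  have hF' : MemLp F' 1 volume := by
    rw [memLp_one_iff_integrable]
    refine hM.mono' (hcC.mul hFm).aestronglyMeasurable (ae_of_all _ fun ξ => ?_)
    simp only [F', norm_mul, Complex.norm_real]
    rw [Real.norm_of_nonneg (by positivity)]
  have hg : (fun ξ : Plane => (((1 + ‖ξ‖ ^ 2) ^ M : ℝ) : ℂ)).HasTemperateGrowth :=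
    Function.Complex.hasTemperateGrowth_ofReal.comp (hasTemperateGrowth_bracket M)
  refine ⟨TemperedDistribution.smulLeftCLM ℂ (fun ξ : Plane => (((1 + ‖ξ‖ ^ 2) ^ M : ℝ) : ℂ))
    (Lp.toTemperedDistribution (hF'.toLp F')), fun ψ => ?_⟩
  rw [TemperedDistribution.smulLeftCLM_apply_apply, Lp.toTemperedDistribution_apply]
  refine integral_congr_ae ?_
  filter_upwards [hF'.coeFn_toLp] with ξ hξ
  rw [hξ, SchwartzMap.smulLeftCLM_apply_apply hg]
  simp only [F', smul_eq_mul, Complex.ofReal_inv]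
  have : (((1 + ‖ξ‖ ^ 2) ^ M : ℝ) : ℂ) ≠ 0 := by
    rw [Complex.ofReal_ne_zero]; positivity
  field_simp

end Tempered

/-! ### Multipliers on the Fourier side. -/

section Symbols

variable {φ χ ψ : ℝ → ℝ}

lemma IsRadialProfile.hasTemperateGrowth_isoSymbol_complex (h : IsRadialProfile ψ) (j : ℤ) :
    (fun ξ => (isoSymbol ψ j ξ : ℂ)).HasTemperateGrowth :=
  Function.Complex.hasTemperateGrowth_ofReal.comp (h.hasTemperateGrowth_isoSymbol j)

lemma IsRadialProfile.hasTemperateGrowth_horSymbol_complex (h : IsRadialProfile ψ) (k : ℤ) :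
    (fun ξ => (horSymbol ψ k ξ : ℂ)).HasTemperateGrowth :=
  Function.Complex.hasTemperateGrowth_ofReal.comp (h.hasTemperateGrowth_horSymbol k)

lemma IsDyadicPartition.hasTemperateGrowth_blockSymbol_complex (h : IsDyadicPartition φ χ)
    (p : ℤ × ℤ) : (fun ξ => (blockSymbol φ p ξ : ℂ)).HasTemperateGrowth :=
  Function.Complex.hasTemperateGrowth_ofReal.comp (h.hasTemperateGrowth_blockSymbol p)

lemma isoBlock_apply (ψ : ℝ → ℝ) (j : ℤ) (u : 𝓢'(Plane, ℂ)) (θ : 𝓢(Plane, ℂ)) :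
    isoBlock ψ j u θ =
      (𝓕 u) (SchwartzMap.smulLeftCLM ℂ (fun ξ => (isoSymbol ψ j ξ : ℂ)) (𝓕⁻ θ)) := rfl

lemma horBlock_apply (ψ : ℝ → ℝ) (k : ℤ) (u : 𝓢'(Plane, ℂ)) (θ : 𝓢(Plane, ℂ)) :
    horBlock ψ k u θ =
      (𝓕 u) (SchwartzMap.smulLeftCLM ℂ (fun ξ => (horSymbol ψ k ξ : ℂ)) (𝓕⁻ θ)) := rfl

lemma fourier_block (h : IsDyadicPartition φ χ) (p : ℤ × ℤ) (u : 𝓢'(Plane, ℂ)) :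
    𝓕 (isoBlock φ p.1 (horBlock φ p.2 u)) =
      TemperedDistribution.smulLeftCLM ℂ (fun ξ => (blockSymbol φ p ξ : ℂ)) (𝓕 u) := by
  have h1 := h.isRadialProfile_ring.hasTemperateGrowth_isoSymbol_complex p.1
  have h2 := h.isRadialProfile_ring.hasTemperateGrowth_horSymbol_complex p.2
  have e1 : ∀ v : 𝓢'(Plane, ℂ), 𝓕 (isoBlock φ p.1 v) =
      TemperedDistribution.smulLeftCLM ℂ (fun ξ => (isoSymbol φ p.1 ξ : ℂ)) (𝓕 v) := fun v =>
    fourier_fourierInv_eq _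
  have e2 : ∀ v : 𝓢'(Plane, ℂ), 𝓕 (horBlock φ p.2 v) =
      TemperedDistribution.smulLeftCLM ℂ (fun ξ => (horSymbol φ p.2 ξ : ℂ)) (𝓕 v) := fun v =>
    fourier_fourierInv_eq _
  rw [e1, e2, TemperedDistribution.smulLeftCLM_smulLeftCLM_apply h2 h1]
  congr 2
  ext ξ
  simp [blockSymbol, mul_comm]

lemma IsRadialProfile.exists_norm_isoSymbol_le (h : IsRadialProfile ψ) :
    ∃ M : ℝ, 0 ≤ M ∧ ∀ j ξ, ‖(isoSymbol ψ j ξ : ℂ)‖ ≤ M := by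
  obtain ⟨M, hM0, hM⟩ := h.exists_bound
  refine ⟨M, hM0, fun j ξ => ?_⟩
  rw [Complex.norm_real, Real.norm_eq_abs]
  exact hM _ (by positivity)

lemma IsRadialProfile.exists_norm_horSymbol_le (h : IsRadialProfile ψ) :
    ∃ M : ℝ, 0 ≤ M ∧ ∀ k ξ, ‖(horSymbol ψ k ξ : ℂ)‖ ≤ M := by
  obtain ⟨M, hM0, hM⟩ := h.exists_bound
  refine ⟨M, hM0, fun j ξ => ?_⟩
  rw [Complex.norm_real, Real.norm_eq_abs]
  exact hM _ (by positivity)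

lemma IsDyadicPartition.exists_norm_blockSymbol_le (h : IsDyadicPartition φ χ) :
    ∃ M : ℝ, 0 ≤ M ∧ ∀ p ξ, ‖(blockSymbol φ p ξ : ℂ)‖ ≤ M := by
  obtain ⟨M, hM0, hM⟩ := h.isRadialProfile_ring.exists_norm_isoSymbol_le
  obtain ⟨N, hN0, hN⟩ := h.isRadialProfile_ring.exists_norm_horSymbol_le
  refine ⟨M * N, by positivity, fun p ξ => ?_⟩
  rw [blockSymbol, Complex.ofReal_mul, norm_mul]
  exact mul_le_mul (hM _ _) (hN _ _) (norm_nonneg _) hM0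

/-- The low horizontal frequencies of a tempered function tend to zero. -/
lemma IsDyadicPartition.tendsto_integral_horSymbol (h : IsDyadicPartition φ χ) {F : Plane → ℂ}
    (hF : IsTempered F) (θ : 𝓢(Plane, ℂ)) :
    Tendsto (fun k : ℤ => ∫ ξ, (horSymbol χ k ξ : ℂ) * θ ξ * F ξ) atBot (𝓝 0) := by
  obtain ⟨M, hM0, hM⟩ := h.isRadialProfile_ball.exists_norm_horSymbol_le
  have hθF : Integrable fun ξ => θ ξ * F ξ :=
    hF.integrable_mul θ.continuous.measurable (rapidDecay_schwartz θ)
  have hzero : (0 : ℂ) = ∫ _ : Plane, (0 : ℂ) := by simp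
  rw [hzero]
  have : (atBot : Filter ℤ).IsCountablyGenerated := inferInstance
  refine tendsto_integral_filter_of_dominated_convergence (fun ξ => M * ‖θ ξ * F ξ‖) ?_ ?_ ?_ ?_
  · refine Eventually.of_forall fun k => Measurable.aestronglyMeasurable ?_
    exact ((h.isRadialProfile_ball.hasTemperateGrowth_horSymbol_complex k).1.continuous.measurable.mul
      θ.continuous.measurable).mul hF.1
  · refine Eventually.of_forall fun k => ae_of_all _ fun ξ => ?_
    rw [mul_assoc, norm_mul]
    gcongr
    exact hM k ξ
  · exact hθF.norm.const_mul M
  -- Off the null line the cut-off is exactly zero once 2^k is small compared with |ξ₁|.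
  · filter_upwards [ae_zero_coord_ne] with ξ hξ
    have ht := abs_coord_pos hξ
    refine tendsto_const_nhds.congr' ?_
    filter_upwards [eventually_lt_atBot (Int.log 2 |((2 * Real.pi) • ξ) 0| )] with k hk
    have h1 := Int.zpow_log_le_self (R := ℝ) one_lt_two ht
    push_cast at h1
    have h2 : (2 : ℝ) ^ (k + 1) ≤ 2 ^ (Int.log 2 |((2 * Real.pi) • ξ) 0|) :=
      zpow_le_zpow_right₀ (by norm_num) (by omega)
    have h3 : horSymbol χ k ξ = 0 := by
      refine h.ball_eq_zero ?_
      have h4 : (2 : ℝ) ^ (-k) * 2 ^ (k + 1) ≤ 2 ^ (-k) * |((2 * Real.pi) • ξ) 0| := by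
        gcongr
        linarith
      rw [← zpow_add₀ (by norm_num)] at h4
      simp only [neg_add_cancel_left, zpow_one] at h4
      linarith
    simp [h3]

end Symbols

/-! ### Existence of the frequency function of a Besov element. -/

section FrequencyFunction

variable {φ χ : ℝ → ℝ}

/-- L² embeds injectively into tempered distributions, so the infimum in `l2Norm` runs over at most
one element. -/
lemma exists_lp_of_l2Norm_ne_top {u : 𝓢'(Plane, ℂ)} (h : l2Norm u ≠ ⊤) :
    ∃ f : Lp ℂ 2 (volume : Measure Plane), Lp.toTemperedDistribution f = u ∧ ‖f‖ₑ = l2Norm u := by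
  have hex : ∃ f : Lp ℂ 2 (volume : Measure Plane), Lp.toTemperedDistribution f = u := by
    by_contra! hcon
    exact h (by simp [l2Norm, hcon])
  obtain ⟨f, hf⟩ := hex
  refine ⟨f, hf, le_antisymm ?_ (iInf₂_le f hf)⟩
  refine le_iInf₂ fun g hg => ?_
  have hinj := LinearMap.ker_eq_bot.1
    (Lp.ker_toTemperedDistributionCLM_eq_bot (F := ℂ) (μ := (volume : Measure Plane)) (p := 2))
  have : f = g := hinj (by
    change Lp.toTemperedDistribution f = Lp.toTemperedDistribution g
    rw [hf, hg])
  rw [this]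

lemma lTwo_enorm_eq {f : Plane → ℂ} : lTwo volume (fun ξ => ‖f ξ‖ₑ) = eLpNorm f 2 volume := by
  rw [eLpNorm_eq_eLpNorm' (by simp) (by simp)]
  simp [lTwo, eLpNorm']

lemma lTwo_enorm_lp (f : Lp ℂ 2 (volume : Measure Plane)) :
    lTwo volume (fun ξ => ‖f ξ‖ₑ) = ‖f‖ₑ := by
  rw [Lp.enorm_def, lTwo_enorm_eq]

lemma ae_eq_of_integral_schwartz {f g : Plane → ℂ} (hf : LocallyIntegrable f)
    (hg : LocallyIntegrable g) (h : ∀ θ : 𝓢(Plane, ℂ), ∫ ξ, θ ξ * f ξ = ∫ ξ, θ ξ * g ξ) :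
    ∀ᵐ ξ, f ξ = g ξ := by
  refine ae_eq_of_integral_contDiff_smul_eq hf hg fun ρ hρ hρc => ?_
  have h1 : HasCompactSupport (Complex.ofRealCLM ∘ ρ) := hρc.comp_left rfl
  have h2 : ContDiff ℝ ∞ (Complex.ofRealCLM ∘ ρ) := by fun_prop
  simpa using h (h1.toSchwartzMap h2)

lemma IsDyadicPartition.exists_blocks (h : IsDyadicPartition φ χ) {s τ : ℝ} {a : 𝓢'(Plane, ℂ)}
    (ha : besovNorm φ s τ a ≠ ⊤) :
    ∃ f : ℤ × ℤ → Lp ℂ 2 (volume : Measure Plane),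
      (∀ p, ‖f p‖ₑ = l2Norm (isoBlock φ p.1 (horBlock φ p.2 a))) ∧
      ∀ p (θ : 𝓢(Plane, ℂ)), ∫ ξ, θ ξ * f p ξ =
        (𝓕 a) (SchwartzMap.smulLeftCLM ℂ (fun ξ => (blockSymbol φ p ξ : ℂ)) θ) := by
  have hfin : ∀ p : ℤ × ℤ, l2Norm (isoBlock φ p.1 (horBlock φ p.2 a)) ≠ ⊤ := by
    intro p htop
    have h1 := ENNReal.ne_top_of_tsum_ne_top ha p
    rw [htop] at h1
    exact h1 (ENNReal.mul_top (dyadicWeight_ne_zero s τ p))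
  choose f hf hfn using fun p => exists_lp_of_l2Norm_ne_top (hfin p)
  refine ⟨fun p => 𝓕 (f p), fun p => ?_, fun p θ => ?_⟩
  · rw [← hfn p, ← ofReal_norm, Lp.norm_fourier_eq, ofReal_norm]
  · have h1 := fourier_block h p a
    rw [← hf p, Lp.fourier_toTemperedDistribution_eq] at h1
    have h2 := congrArg (fun u : 𝓢'(Plane, ℂ) => u θ) h1
    simpa using h2

/-- Both sides represent the product of the two symbols with the Fourier transform of a. -/
lemma IsDyadicPartition.blocks_compatible (h : IsDyadicPartition φ χ) {a : 𝓢'(Plane, ℂ)}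
    {f : ℤ × ℤ → Lp ℂ 2 (volume : Measure Plane)}
    (hf : ∀ p (θ : 𝓢(Plane, ℂ)), ∫ ξ, θ ξ * f p ξ =
        (𝓕 a) (SchwartzMap.smulLeftCLM ℂ (fun ξ => (blockSymbol φ p ξ : ℂ)) θ)) (p q : ℤ × ℤ) :
    ∀ᵐ ξ, (blockSymbol φ p ξ : ℂ) * f q ξ = (blockSymbol φ q ξ : ℂ) * f p ξ := by
  obtain ⟨M, hM0, hM⟩ := h.exists_norm_blockSymbol_le
  have hloc : ∀ p q, LocallyIntegrable fun ξ => (blockSymbol φ p ξ : ℂ) * f q ξ := by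
    intro p q
    refine ((Lp.memLp (f q)).of_le_mul (c := M) ?_ (ae_of_all _ fun ξ => ?_)).locallyIntegrable
      one_le_two
    · exact ((h.hasTemperateGrowth_blockSymbol_complex p).1.continuous.measurable.mul
        (Lp.stronglyMeasurable (f q)).measurable).aestronglyMeasurable
    · rw [norm_mul]
      gcongr
      exact hM p ξ
  have hpair : ∀ (p q : ℤ × ℤ) (θ : 𝓢(Plane, ℂ)), ∫ ξ, θ ξ * ((blockSymbol φ p ξ : ℂ) * f q ξ) =
      (𝓕 a) (SchwartzMap.smulLeftCLM ℂ (fun ξ => (blockSymbol φ q ξ : ℂ))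
        (SchwartzMap.smulLeftCLM ℂ (fun ξ => (blockSymbol φ p ξ : ℂ)) θ)) := by
    intro p q θ
    rw [← hf]
    congr with ξ
    rw [SchwartzMap.smulLeftCLM_apply_apply (h.hasTemperateGrowth_blockSymbol_complex p), smul_eq_mul]
    ring
  refine ae_eq_of_integral_schwartz (hloc p q) (hloc q p) fun θ => ?_
  rw [hpair, hpair,
    SchwartzMap.smulLeftCLM_smulLeftCLM_apply (h.hasTemperateGrowth_blockSymbol_complex q)
      (h.hasTemperateGrowth_blockSymbol_complex p),
    SchwartzMap.smulLeftCLM_smulLeftCLM_apply (h.hasTemperateGrowth_blockSymbol_complex p)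
      (h.hasTemperateGrowth_blockSymbol_complex q), mul_comm]

lemma IsDyadicPartition.tsum_tsum_blockSymbol (h : IsDyadicPartition φ χ) {ξ : Plane}
    (hξ : ξ 0 ≠ 0) : ∑' j : ℤ, ∑' k : ℤ, (blockSymbol φ (j, k) ξ : ℂ) = 1 := by
  have h1 := (h.sum_homogeneous _ (norm_two_pi_pos hξ)).tsum_eq
  have h2 := (h.sum_homogeneous _ (abs_coord_pos hξ)).tsum_eq
  have h3 : ∑' j : ℤ, ∑' k : ℤ, blockSymbol φ (j, k) ξ = 1 := by
    unfold blockSymbol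
    simp_rw [tsum_mul_left, tsum_mul_right]
    unfold isoSymbol horSymbol
    rw [h1, h2, one_mul]
  simp_rw [← Complex.ofReal_tsum, h3, Complex.ofReal_one]

/-- The frequency function glued from compatible dyadic blocks. -/
lemma IsDyadicPartition.exists_glue (h : IsDyadicPartition φ χ) {f : ℤ × ℤ → Plane → ℂ}
    (hfm : ∀ p, Measurable (f p))
    (hf : ∀ p q, ∀ᵐ ξ, (blockSymbol φ p ξ : ℂ) * f q ξ = (blockSymbol φ q ξ : ℂ) * f p ξ) :
    ∃ F : Plane → ℂ, Measurable F ∧ ∀ p, ∀ᵐ ξ, (blockSymbol φ p ξ : ℂ) * F ξ = f p ξ := by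
  -- Summability need not be checked: in a field constants leave `tsum` unconditionally.
  -- Compatibility turns the p-th symbol times the sum into f p times the sum of all symbols, which
  -- is 1.
  refine ⟨fun ξ => ∑' j : ℤ, ∑' k : ℤ, f (j, k) ξ,
    Measurable.tsum fun j => Measurable.tsum fun k => hfm (j, k), fun p => ?_⟩
  have hall : ∀ᵐ ξ, ∀ q, (blockSymbol φ p ξ : ℂ) * f q ξ = (blockSymbol φ q ξ : ℂ) * f p ξ :=
    ae_all_iff.2 fun q => hf p q
  filter_upwards [hall, ae_zero_coord_ne] with ξ hξ hξ0
  rw [← tsum_mul_left]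
  simp_rw [← tsum_mul_left, hξ, tsum_mul_right]
  rw [h.tsum_tsum_blockSymbol hξ0, one_mul]

lemma le_log_of_horSymbol_ne_one (h : IsDyadicPartition φ χ) {k : ℤ} {ξ : Plane} (hξ : ξ 0 ≠ 0)
    (hk : horSymbol χ k ξ ≠ 1) : k - 1 ≤ Int.log 2 |((2 * Real.pi) • ξ) 0| := by
  have ht := abs_coord_pos hξ
  have h1 := Int.zpow_le_iff_le_log (R := ℝ) (b := 2) one_lt_two (x := k - 1) ht
  push_cast at h1
  rw [← h1]
  by_contra! hcon
  refine hk (h.ball_eq_one (by positivity) ?_)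
  have h4 : (2 : ℝ) ^ (-k) * |((2 * Real.pi) • ξ) 0| ≤ 2 ^ (-k) * 2 ^ (k - 1) := by gcongr
  rw [← zpow_add₀ (by norm_num), show -k + (k - 1) = -1 by ring] at h4
  rw [show (2 : ℝ) ^ (-1 : ℤ) = 1 / 2 by norm_num] at h4
  linarith

lemma log_le_of_isoSymbol_ne_zero (h : IsDyadicPartition φ χ) {n : ℤ} {ξ : Plane} (hξ : ξ 0 ≠ 0)
    (hn : isoSymbol χ n ξ ≠ 0) : Int.log 2 ‖(2 * Real.pi) • ξ‖ ≤ n := by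
  have ht := norm_two_pi_pos hξ
  have h2 := Int.lt_zpow_iff_log_lt (R := ℝ) (b := 2) one_lt_two (x := n + 1) ht
  push_cast at h2
  suffices Int.log 2 ‖(2 * Real.pi) • ξ‖ < n + 1 by omega
  rw [← h2]
  by_contra! hcon
  refine hn (h.ball_eq_zero ?_)
  have h4 : (2 : ℝ) ^ (-n) * 2 ^ (n + 1) ≤ 2 ^ (-n) * ‖(2 * Real.pi) • ξ‖ := by gcongr
  rw [← zpow_add₀ (by norm_num), show -n + (n + 1) = 1 by ring, zpow_one] at h4
  linarith

/-- Frequencies that survive both cut-offs satisfy k - 1 ≤ log|ξ₁| ≤ log|ξ| ≤ n in integer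
logarithms; the window is one wider at each end, so its blocks sum to 1 there. -/
lemma sum_blockSymbol_mul_cutoff (h : IsDyadicPartition φ χ) {n k : ℤ} {ξ : Plane}
    (hξ : ξ 0 ≠ 0) :
    (∑ p ∈ Finset.Icc (k - 2) (n + 1) ×ˢ Finset.Icc (k - 2) (n + 1), blockSymbol φ p ξ) *
      ((1 - horSymbol χ k ξ) * isoSymbol χ n ξ) = (1 - horSymbol χ k ξ) * isoSymbol χ n ξ := by
  by_cases h1 : horSymbol χ k ξ = 1
  · simp [h1]
  by_cases h2 : isoSymbol χ n ξ = 0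
  · simp [h2]
  have hk := le_log_of_horSymbol_ne_one h hξ h1
  have hn := log_le_of_isoSymbol_ne_zero h hξ h2
  have hkn : Int.log 2 |((2 * Real.pi) • ξ) 0| ≤ Int.log 2 ‖(2 * Real.pi) • ξ‖ :=
    Int.log_mono_right (abs_coord_pos hξ) (PiLp.norm_apply_le ((2 * Real.pi) • ξ) 0)
  have hsum : ∑ p ∈ Finset.Icc (k - 2) (n + 1) ×ˢ Finset.Icc (k - 2) (n + 1),
      blockSymbol φ p ξ = 1 := by
    unfold blockSymbol
    rw [Finset.sum_product]
    simp_rw [← Finset.mul_sum, ← Finset.sum_mul]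
    unfold isoSymbol horSymbol
    rw [h.sum_ring_eq_one (norm_two_pi_pos hξ), h.sum_ring_eq_one (abs_coord_pos hξ), one_mul]
    · exact Finset.Icc_subset_Icc (by omega) (by omega)
    · exact Finset.Icc_subset_Icc (by omega) (by omega)
  rw [hsum, one_mul]

/-- An element of the Besov space has a frequency function. -/
theorem IsDyadicPartition.exists_frequency (h : IsDyadicPartition φ χ) {s τ : ℝ} (hs : s ≤ 1 / 2)
    (hτ : τ ≤ 1 / 2) {a : 𝓢'(Plane, ℂ)} (ha : MemBesov φ χ s τ a) :
    ∃ F : Plane → ℂ, IsTempered F ∧ freqNorm φ s τ (fun ξ => ‖F ξ‖ₑ) = besovNorm φ s τ a ∧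
      ∀ (n : ℤ) (θ : 𝓢(Plane, ℂ)), isoBlock χ n a θ =
        ∫ ξ, (𝓕⁻ θ) ξ * ((isoSymbol χ n ξ : ℂ) * F ξ) := by
  obtain ⟨f, hfn, hf⟩ := h.exists_blocks ha.1.ne
  obtain ⟨F, hFm, hF⟩ := h.exists_glue (f := fun p ξ => f p ξ)
    (fun p => (Lp.stronglyMeasurable (f p)).measurable) (h.blocks_compatible hf)
  have hnorm : freqNorm φ s τ (fun ξ => ‖F ξ‖ₑ) = besovNorm φ s τ a := by
    unfold freqNorm besovNorm
    congr with p
    rw [← hfn p, ← lTwo_enorm_lp]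
    unfold dyadicWeight
    congr 1
    refine lTwo_congr_ae ?_
    filter_upwards [hF p] with ξ hξ
    rw [← hξ, enorm_mul]
    congr 1
    rw [← ofReal_norm, ← ofReal_norm, Complex.norm_real]
  have hFt : IsTempered F := by
    obtain ⟨C, hC, hle⟩ := h.exists_tileNorm_le s τ
    refine isTempered_of_tileNorm hs hτ hFm hFm.enorm (fun ξ => le_rfl)
      (ne_top_of_le_ne_top ?_ (hle _ hFm.enorm))
    rw [hnorm]
    exact ENNReal.mul_ne_top hC ha.1.ne
  refine ⟨F, hFt, hnorm, fun n θ => ?_⟩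
  have hχ := h.isRadialProfile_ball.hasTemperateGrowth_isoSymbol_complex n
  have hη := h.isRadialProfile_ball.hasTemperateGrowth_horSymbol_complex
  rw [isoBlock_apply]
  set η : 𝓢(Plane, ℂ) := SchwartzMap.smulLeftCLM ℂ (fun ξ => (isoSymbol χ n ξ : ℂ)) (𝓕⁻ θ)
    with hηdef
  have hηv : ∀ ξ, η ξ = (isoSymbol χ n ξ : ℂ) * (𝓕⁻ θ) ξ := fun ξ => by
    rw [hηdef, SchwartzMap.smulLeftCLM_apply_apply hχ, smul_eq_mul]
  have hint : ∀ ψ : 𝓢(Plane, ℂ), Integrable fun ξ => ψ ξ * F ξ := fun ψ =>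
    hFt.integrable_mul ψ.continuous.measurable (rapidDecay_schwartz ψ)
  -- The test function is split at horizontal frequency 2^k. The high part meets finitely many
  -- blocks, where the Fourier transform of a is given by F; the low part is S_k^h a tested on a
  -- fixed function.
  have hsplit : ∀ k : ℤ, (𝓕 a) η = horBlock χ k a (𝓕 η) +
      ((∫ ξ, η ξ * F ξ) - ∫ ξ, (horSymbol χ k ξ : ℂ) * η ξ * F ξ) := by
    intro k
    set ηk : 𝓢(Plane, ℂ) := SchwartzMap.smulLeftCLM ℂ (fun ξ => (horSymbol χ k ξ : ℂ)) η with hηk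
    have hηkv : ∀ ξ, ηk ξ = (horSymbol χ k ξ : ℂ) * η ξ := fun ξ => by
      rw [hηk, SchwartzMap.smulLeftCLM_apply_apply (hη k), smul_eq_mul]
    have e1 : horBlock χ k a (𝓕 η) = (𝓕 a) ηk := by
      rw [horBlock_apply, FourierTransform.fourierInv_fourier_eq]
    set S := Finset.Icc (k - 2) (n + 1) ×ˢ Finset.Icc (k - 2) (n + 1)
    have hpt : ∀ ξ : Plane, ξ 0 ≠ 0 → (∑ p ∈ S, (blockSymbol φ p ξ : ℂ)) * (η ξ - ηk ξ) =
        η ξ - ηk ξ := by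
      intro ξ hξ
      have h1 := congrArg (fun x : ℝ => (x : ℂ))
        (sum_blockSymbol_mul_cutoff h (n := n) (k := k) hξ)
      push_cast at h1
      rw [hηkv, hηv]
      linear_combination (𝓕⁻ θ) ξ * h1
    have e3 : η - ηk = ∑ p ∈ S,
        SchwartzMap.smulLeftCLM ℂ (fun ξ => (blockSymbol φ p ξ : ℂ)) (η - ηk) := by
      have hcont : Continuous fun ξ : Plane => (∑ p ∈ S, (blockSymbol φ p ξ : ℂ)) * (η ξ - ηk ξ) :=
        (continuous_finsetSum _ fun p _ =>
          (h.hasTemperateGrowth_blockSymbol_complex p).1.continuous).mul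
          (η.continuous.sub ηk.continuous)
      -- The identity holds off the null line `ξ 0 = 0`; continuity extends it to every frequency.
      have heq := Continuous.ae_eq_iff_eq (μ := (volume : Measure Plane)) hcont
        (η.continuous.sub ηk.continuous)
      have h2 := heq.1 (by filter_upwards [ae_zero_coord_ne] with ξ hξ using hpt ξ hξ)
      ext ξ
      have h3 := congrFun h2 ξ
      rw [sum_apply]
      simp only [SchwartzMap.smulLeftCLM_apply_apply (h.hasTemperateGrowth_blockSymbol_complex _),
        sub_apply, smul_eq_mul]
      rw [← Finset.sum_mul, h3]
      rfl
    have e2 : (𝓕 a) (η - ηk) = ∫ ξ, (η - ηk) ξ * F ξ := by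
      have hterm : ∀ p, (𝓕 a) (SchwartzMap.smulLeftCLM ℂ (fun ξ => (blockSymbol φ p ξ : ℂ))
          (η - ηk)) = ∫ ξ, (SchwartzMap.smulLeftCLM ℂ (fun ξ => (blockSymbol φ p ξ : ℂ))
            (η - ηk)) ξ * F ξ := by
        intro p
        rw [← hf p]
        refine integral_congr_ae ?_
        filter_upwards [hF p] with ξ hξ
        rw [← hξ, SchwartzMap.smulLeftCLM_apply_apply (h.hasTemperateGrowth_blockSymbol_complex p),
          smul_eq_mul]
        ring
      conv_lhs => rw [e3, map_sum]
      simp_rw [hterm]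
      rw [← integral_finsetSum _ fun p _ => hint _]
      congr with ξ
      rw [← Finset.sum_mul, ← sum_apply, ← e3]
    have e4 : (𝓕 a) η = (𝓕 a) ηk + (𝓕 a) (η - ηk) := by
      rw [← map_add, add_sub_cancel]
    rw [e4, e1, e2]
    congr 1
    simp_rw [← hηkv]
    rw [← integral_sub (hint η) (hint ηk)]
    congr with ξ
    rw [sub_apply, sub_mul]
  -- As k → -∞ both low-frequency terms vanish, the first by the membership condition, while the
  -- left side of `hsplit` does not depend on k.
  have hlim1 : Tendsto (fun k : ℤ => horBlock χ k a (𝓕 η)) atBot (𝓝 0) :=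
    PointwiseConvergenceCLM.tendsto_iff_forall_tendsto.1 ha.2 (𝓕 η)
  have hlim2 := h.tendsto_integral_horSymbol hFt η
  have hlim := hlim1.add ((tendsto_const_nhds (x := ∫ ξ, η ξ * F ξ)).sub hlim2)
  rw [sub_zero, zero_add] at hlim
  have hconst : Tendsto (fun _ : ℤ => (𝓕 a) η) atBot (𝓝 (∫ ξ, η ξ * F ξ)) :=
    hlim.congr fun k => (hsplit k).symm
  rw [tendsto_nhds_unique tendsto_const_nhds hconst]
  congr with ξ
  rw [hηv]
  ring

end FrequencyFunction

/-! ### Inverse Fourier integrals, convolution and multiplication. -/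

section FourierIntegral

lemma RapidDecay.norm_pow_mul {m : Plane → ℂ} (hm : RapidDecay m) (n : ℕ) :
    RapidDecay fun ξ => ((‖ξ‖ ^ n : ℝ) : ℂ) * m ξ := by
  intro M
  obtain ⟨C, hC⟩ := hm (M + n)
  have hC0 : 0 ≤ C := by simpa using (norm_nonneg _).trans (hC 0)
  refine ⟨C, fun ξ => ?_⟩
  rw [norm_mul, Complex.norm_real, Real.norm_of_nonneg (by positivity)]
  have h1 : ‖ξ‖ ^ n ≤ (1 + ‖ξ‖ ^ 2) ^ n := by
    gcongr
    nlinarith [sq_nonneg (‖ξ‖ - 1)]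
  calc ‖ξ‖ ^ n * ‖m ξ‖ ≤ (1 + ‖ξ‖ ^ 2) ^ n * (C * ((1 + ‖ξ‖ ^ 2) ^ (M + n))⁻¹) := by
        gcongr
        exact hC ξ
    _ = C * ((1 + ‖ξ‖ ^ 2) ^ M)⁻¹ := by
        rw [pow_add]
        field_simp

lemma IsTempered.integrable_moment {F m : Plane → ℂ} (hF : IsTempered F) (hm : Measurable m)
    (hd : RapidDecay m) (n : ℕ) : Integrable fun ξ => ‖ξ‖ ^ n * ‖m ξ * F ξ‖ := by
  have h := hF.integrable_mul (g := fun ξ => ((‖ξ‖ ^ n : ℝ) : ℂ) * m ξ) (by fun_prop)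
    (hd.norm_pow_mul n)
  refine h.norm.congr (ae_of_all _ fun ξ => ?_)
  simp only [norm_mul, Complex.norm_real]
  rw [Real.norm_of_nonneg (by positivity), mul_assoc]

lemma hasTemperateGrowth_fourier {f : Plane → ℂ} (hfm : AEStronglyMeasurable f)
    (hf : ∀ n : ℕ, Integrable fun ξ => ‖ξ‖ ^ n * ‖f ξ‖) : (𝓕 f).HasTemperateGrowth := by
  -- Growth exponent 0: each derivative is bounded by an L¹ norm.
  refine ⟨Real.contDiff_fourier fun n _ => hf n, fun n => ⟨0,
    ∫ v, ‖VectorFourier.fourierPowSMulRight (innerSL ℝ) f v n‖, fun ξ => ?_⟩⟩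
  rw [Real.iteratedFDeriv_fourier (N := ⊤) (fun n _ => hf n) hfm le_top, pow_zero, mul_one]
  exact VectorFourier.norm_fourierIntegral_le_integral_norm _ _ _ _ _

lemma hasTemperateGrowth_fourierInv {f : Plane → ℂ} (hfm : Measurable f)
    (hf : ∀ n : ℕ, Integrable fun ξ => ‖ξ‖ ^ n * ‖f ξ‖) : (𝓕⁻ f).HasTemperateGrowth := by
  rw [Real.fourierInv_eq_fourier_comp_neg]
  refine hasTemperateGrowth_fourier (hfm.comp measurable_neg).aestronglyMeasurable fun n => ?_
  simpa using (hf n).comp_neg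

lemma integral_fourierInv_mul {f g : Plane → ℂ} (hf : Integrable f) (hg : Integrable g) :
    ∫ x, (𝓕⁻ f) x * g x = ∫ ξ, f ξ * (𝓕⁻ g) ξ := by
  have h := VectorFourier.integral_fourierIntegral_smul_eq_flip (μ := (volume : Measure Plane))
    (ν := (volume : Measure Plane)) (L := -innerₗ Plane) (e := Real.fourierChar) (f := f) (g := g)
    Real.continuous_fourierChar (by
      have : Continuous fun p : Plane × Plane => -inner ℝ p.1 p.2 := by fun_prop
      exact this) hf hg
  have hflip : (-innerₗ Plane).flip = -innerₗ Plane := by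
    ext x y
    simp [real_inner_comm]
  rw [hflip] at h
  exact h

lemma integral_schwartz_mul_fourierInv (θ : 𝓢(Plane, ℂ)) {g : Plane → ℂ} (hg : Integrable g) :
    ∫ x, θ x * (𝓕⁻ g) x = ∫ ξ, (𝓕⁻ θ) ξ * g ξ := by
  rw [SchwartzMap.fourierInv_coe]
  exact (integral_fourierInv_mul θ.integrable hg).symm

lemma fourierInv_convolution {f g : Plane → ℂ} (hf : Integrable f) (hg : Integrable g)
    (x : Plane) : (𝓕⁻ fun z => ∫ t, f t * g (z - t)) x = (𝓕⁻ f) x * (𝓕⁻ g) x := by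
  simp_rw [Real.fourierInv_eq_fourier_neg]
  exact Real.fourier_mul_convolution_eq hf hg (-x)

lemma integrable_convolution {f g : Plane → ℂ} (hf : Integrable f) (hg : Integrable g) :
    Integrable fun z => ∫ t, f t * g (z - t) :=
  hf.integrable_convolution (ContinuousLinearMap.mul ℂ ℂ) hg

/-- If `f` and `g` are integrable, all moments of `f` are finite and `u` is the distribution with
density `𝓕⁻ g`, then the product of `u` with `𝓕⁻ f` has density `𝓕⁻ (f ⋆ g)`. -/
lemma smulLeftCLM_fourierInv_apply {f g : Plane → ℂ} (hfm : Measurable f)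
    (hf : ∀ n : ℕ, Integrable fun ξ => ‖ξ‖ ^ n * ‖f ξ‖) (hg : Integrable g) {u : 𝓢'(Plane, ℂ)}
    (hu : ∀ θ : 𝓢(Plane, ℂ), u θ = ∫ ξ, (𝓕⁻ θ) ξ * g ξ) (θ : 𝓢(Plane, ℂ)) :
    TemperedDistribution.smulLeftCLM ℂ (𝓕⁻ f) u θ =
      ∫ z, (𝓕⁻ θ) z * ∫ t, f t * g (z - t) := by
  have hfi : Integrable f := by
    have h0 := hf 0
    simp only [pow_zero, one_mul] at h0
    exact (integrable_norm_iff hfm.aestronglyMeasurable).1 h0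
  rw [TemperedDistribution.smulLeftCLM_apply_apply, hu, ← integral_schwartz_mul_fourierInv _ hg,
    ← integral_schwartz_mul_fourierInv _ (integrable_convolution hfi hg)]
  congr with x
  rw [SchwartzMap.smulLeftCLM_apply_apply (hasTemperateGrowth_fourierInv hfm hf),
    fourierInv_convolution hfi hg, smul_eq_mul]
  ring

end FourierIntegral

/-! ### Besov norm of a distribution with given Fourier density. -/

section BesovNorm

variable {φ χ : ℝ → ℝ}

lemma l2Norm_le_of_fourier {u : 𝓢'(Plane, ℂ)} {f : Plane → ℂ} (hf : Measurable f)
    (h : ∀ θ : 𝓢(Plane, ℂ), (𝓕 u) θ = ∫ ξ, θ ξ * f ξ) :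
    l2Norm u ≤ lTwo volume (fun ξ => ‖f ξ‖ₑ) := by
  rw [lTwo_enorm_eq]
  by_cases htop : eLpNorm f 2 volume = ⊤
  · rw [htop]
    exact le_top
  have hmem : MemLp f 2 volume := ⟨hf.aestronglyMeasurable, lt_top_iff_ne_top.2 htop⟩
  have h1 : (Lp.toTemperedDistribution (hmem.toLp f) : 𝓢'(Plane, ℂ)) = 𝓕 u := by
    ext θ
    rw [h, Lp.toTemperedDistribution_apply]
    refine integral_congr_ae ?_
    filter_upwards [hmem.coeFn_toLp] with ξ hξ
    rw [hξ, smul_eq_mul]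
  have h2 : Lp.toTemperedDistribution (𝓕⁻ (hmem.toLp f)) = u := by
    rw [← Lp.fourierInv_toTemperedDistribution_eq, h1, fourierInv_fourier_eq]
  have h3 : ‖𝓕⁻ (hmem.toLp f)‖ₑ = ‖hmem.toLp f‖ₑ := by
    rw [← ofReal_norm, ← ofReal_norm, ← Lp.norm_fourier_eq, fourier_fourierInv_eq]
  calc l2Norm u ≤ ‖𝓕⁻ (hmem.toLp f)‖ₑ := iInf₂_le (𝓕⁻ (hmem.toLp f)) h2
    _ = eLpNorm f 2 volume := by rw [h3, Lp.enorm_toLp]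

lemma freqNorm_mono (s τ : ℝ) {U V : Plane → ℝ≥0∞} (h : ∀ ξ, U ξ ≤ V ξ) :
    freqNorm φ s τ U ≤ freqNorm φ s τ V := by
  refine ENNReal.tsum_le_tsum fun p => ?_
  gcongr
  refine lTwo_mono fun ξ => ?_
  gcongr
  exact h ξ

lemma IsDyadicPartition.besovNorm_le_freqNorm (h : IsDyadicPartition φ χ) (s τ : ℝ)
    {p : 𝓢'(Plane, ℂ)} {H : Plane → ℂ} (hH : Measurable H)
    (hp : ∀ θ : 𝓢(Plane, ℂ), (𝓕 p) θ = ∫ ξ, θ ξ * H ξ) :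
    besovNorm φ s τ p ≤ freqNorm φ s τ (fun ξ => ‖H ξ‖ₑ) := by
  refine ENNReal.tsum_le_tsum fun q => mul_le_mul_right ?_ _
  have hq := h.hasTemperateGrowth_blockSymbol_complex q
  refine (l2Norm_le_of_fourier (f := fun ξ => (blockSymbol φ q ξ : ℂ) * H ξ)
    (hq.1.continuous.measurable.mul hH) fun θ => ?_).trans_eq ?_
  · rw [fourier_block h q, TemperedDistribution.smulLeftCLM_apply_apply, hp]
    congr with ξ
    rw [SchwartzMap.smulLeftCLM_apply_apply hq, smul_eq_mul]
    ring
  · congr with ξ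
    rw [enorm_mul]
    congr 1
    rw [← ofReal_norm, ← ofReal_norm, Complex.norm_real]

end BesovNorm

/-! ### Convergence of S_n a · S_n b. -/

section Product

variable {φ χ : ℝ → ℝ}

lemma measurable_integral_mul_sub {F G : Plane → ℂ} (hF : Measurable F) (hG : Measurable G) :
    Measurable fun z => ∫ t, F t * G (z - t) := by
  refine StronglyMeasurable.measurable (StronglyMeasurable.integral_prod_right' (ν := volume)
    (f := fun q : Plane × Plane => F q.2 * G (q.1 - q.2)) ?_)
  exact ((hF.comp measurable_snd).mul
    (hG.comp (measurable_fst.sub measurable_snd))).stronglyMeasurable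

lemma lconvolution_enorm {F G : Plane → ℂ} (z : Plane) :
    ((fun ξ => ‖F ξ‖ₑ) ⋆ₗ (fun ξ => ‖G ξ‖ₑ)) z = ∫⁻ t, ‖F t * G (z - t)‖ₑ := by
  rw [lconvolution_def]
  congr with t
  rw [enorm_mul, neg_add_eq_sub]

lemma enorm_integral_mul_sub_le {F G : Plane → ℂ} (z : Plane) :
    ‖∫ t, F t * G (z - t)‖ₑ ≤ ((fun ξ => ‖F ξ‖ₑ) ⋆ₗ (fun ξ => ‖G ξ‖ₑ)) z := by
  rw [lconvolution_enorm]
  exact enorm_integral_le_lintegral_enorm _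

lemma ae_ne_top_of_tileNorm {s τ : ℝ} (hs : s ≤ 1 / 2) (hτ : τ ≤ 1 / 2) {U : Plane → ℝ≥0∞}
    (hU : Measurable U) (h : tileNorm s τ U ≠ ⊤) : ∀ᵐ ξ, U ξ ≠ ⊤ := by
  obtain ⟨M, hM⟩ := exists_lintegral_mul_weight_ne_top hs hτ hU h
  have hc : Continuous fun ξ : Plane => ((1 + ‖ξ‖ ^ 2) ^ M)⁻¹ :=
    Continuous.inv₀ (by fun_prop) fun ξ => by positivity
  filter_upwards [ae_lt_top (hU.mul hc.measurable.ennreal_ofReal) hM] with ξ hξ htop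
  rw [Pi.mul_apply, htop, ENNReal.top_mul] at hξ
  · exact lt_irrefl _ hξ
  · rw [ne_eq, ENNReal.ofReal_eq_zero, not_le]
    positivity

lemma IsDyadicPartition.eventually_isoSymbol_eq_one (h : IsDyadicPartition φ χ) (ξ : Plane) :
    ∀ᶠ n : ℕ in atTop, isoSymbol χ n ξ = 1 := by
  have h1 : Tendsto (fun n : ℕ => ((1 : ℝ) / 2) ^ n * ‖(2 * Real.pi) • ξ‖) atTop (𝓝 0) := by
    simpa using (tendsto_pow_atTop_nhds_zero_of_lt_one (by norm_num : (0 : ℝ) ≤ 1 / 2)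
      (by norm_num)).mul_const ‖(2 * Real.pi) • ξ‖
  filter_upwards [h1.eventually_lt_const (by norm_num : (0 : ℝ) < 3 / 4)] with n hn
  refine h.ball_eq_one (by positivity) ?_
  rwa [zpow_neg, zpow_natCast, ← inv_pow, ← one_div]

lemma IsDyadicPartition.rapidDecay_isoSymbol (h : IsDyadicPartition φ χ) (n : ℤ) :
    RapidDecay fun ξ => (isoSymbol χ n ξ : ℂ) := by
  obtain ⟨M, hM0, hM⟩ := h.isRadialProfile_ball.exists_norm_isoSymbol_le
  refine rapidDecay_of_bounded_support (B := M) (R := 2 ^ n * 2) (fun ξ _ => hM n ξ) fun ξ hξ => ?_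
  rw [isoSymbol, h.ball_eq_zero, Complex.ofReal_zero]
  rw [norm_smul, Real.norm_of_nonneg (by positivity)]
  have h1 : (2 : ℝ) ^ (-n) * (2 ^ n * 2) ≤ 2 ^ (-n) * ‖ξ‖ := by gcongr
  rw [← mul_assoc, ← zpow_add₀ (by norm_num), neg_add_cancel, zpow_zero, one_mul] at h1
  have h2 : 1 * ‖ξ‖ ≤ 2 * Real.pi * ‖ξ‖ := by
    gcongr
    linarith [Real.pi_gt_three]
  calc (4 : ℝ) / 3 < 2 := by norm_num
    _ ≤ 2 ^ (-n) * ‖ξ‖ := h1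
    _ ≤ 2 ^ (-n) * (2 * Real.pi * ‖ξ‖) := by
        gcongr
        linarith

/-- Convolutions of truncated frequency functions converge to the full convolution. -/
lemma IsDyadicPartition.tendsto_truncated_convolution (h : IsDyadicPartition φ χ) {F G : Plane → ℂ}
    (hF : Measurable F) (hG : Measurable G) {z : Plane}
    (hz : ((fun ξ => ‖F ξ‖ₑ) ⋆ₗ (fun ξ => ‖G ξ‖ₑ)) z ≠ ⊤) :
    Tendsto (fun n : ℕ => ∫ t, ((isoSymbol χ n t : ℂ) * F t) *
      ((isoSymbol χ n (z - t) : ℂ) * G (z - t))) atTop (𝓝 (∫ t, F t * G (z - t))) := by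
  obtain ⟨M, hM0, hM⟩ := h.isRadialProfile_ball.exists_norm_isoSymbol_le
  have hχ : ∀ n : ℤ, Measurable fun ξ => (isoSymbol χ n ξ : ℂ) := fun n =>
    (h.isRadialProfile_ball.hasTemperateGrowth_isoSymbol_complex n).1.continuous.measurable
  have hsub : Measurable fun t : Plane => z - t := measurable_const.sub measurable_id
  have hint : Integrable fun t => F t * G (z - t) := by
    refine ⟨(hF.mul (hG.comp hsub)).aestronglyMeasurable, ?_⟩
    rw [lconvolution_enorm] at hz
    exact lt_top_iff_ne_top.2 hz
  refine tendsto_integral_of_dominated_convergence (fun t => M * M * ‖F t * G (z - t)‖)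
    (fun n => (((hχ n).mul hF).mul (((hχ n).mul hG).comp hsub)).aestronglyMeasurable)
    (hint.norm.const_mul _) (fun n => ae_of_all _ fun t => ?_) (ae_of_all _ fun t => ?_)
  · rw [mul_mul_mul_comm, norm_mul, norm_mul]
    gcongr
    · exact hM _ _
    · exact hM _ _
  · refine tendsto_const_nhds.congr' ?_
    filter_upwards [h.eventually_isoSymbol_eq_one t, h.eventually_isoSymbol_eq_one (z - t)]
      with n h1 h2
    rw [h1, h2, Complex.ofReal_one, one_mul, one_mul]

lemma IsDyadicPartition.tendsto_integral_truncated (h : IsDyadicPartition φ χ) {F G : Plane → ℂ}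
    (hF : Measurable F) (hG : Measurable G) {s τ : ℝ} (hs : s ≤ 1 / 2) (hτ : τ ≤ 1 / 2)
    (hW : tileNorm s τ ((fun ξ => ‖F ξ‖ₑ) ⋆ₗ (fun ξ => ‖G ξ‖ₑ)) ≠ ⊤) (θ : 𝓢(Plane, ℂ)) :
    Tendsto (fun n : ℕ => ∫ z, θ z * ∫ t, ((isoSymbol χ n t : ℂ) * F t) *
      ((isoSymbol χ n (z - t) : ℂ) * G (z - t))) atTop (𝓝 (∫ z, θ z * ∫ t, F t * G (z - t))) := by
  obtain ⟨M, hM0, hM⟩ := h.isRadialProfile_ball.exists_norm_isoSymbol_le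
  have hχ : ∀ n : ℤ, Measurable fun ξ => (isoSymbol χ n ξ : ℂ) := fun n =>
    (h.isRadialProfile_ball.hasTemperateGrowth_isoSymbol_complex n).1.continuous.measurable
  set W := (fun ξ => ‖F ξ‖ₑ) ⋆ₗ (fun ξ => ‖G ξ‖ₑ) with hWdef
  have hWm : Measurable W := measurable_lconvolution _ hF.enorm hG.enorm
  -- W can be infinite on a null set; its real part, finite everywhere, is used as the dominating
  -- function.
  have hWt : IsTempered fun z => ((W z).toReal : ℂ) :=
    isTempered_of_tileNorm hs hτ (by fun_prop) hWm (fun z => by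
      rw [← ofReal_norm, Complex.norm_real, Real.norm_of_nonneg ENNReal.toReal_nonneg]
      exact ENNReal.ofReal_toReal_le) hW
  have hfin := ae_ne_top_of_tileNorm hs hτ hWm hW
  have hint : Integrable fun z => θ z * ((W z).toReal : ℂ) :=
    hWt.integrable_mul θ.continuous.measurable (rapidDecay_schwartz θ)
  refine tendsto_integral_of_dominated_convergence
    (fun z => M * M * ‖θ z * ((W z).toReal : ℂ)‖)
    (fun n => (θ.continuous.measurable.mul (measurable_integral_mul_sub ((hχ n).mul hF)
      ((hχ n).mul hG))).aestronglyMeasurable)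
    (hint.norm.const_mul _) (fun n => ?_) ?_
  · filter_upwards [hfin] with z hz
    have h1 : ‖∫ t, ((isoSymbol χ n t : ℂ) * F t) * ((isoSymbol χ n (z - t) : ℂ) * G (z - t))‖ₑ ≤
        ENNReal.ofReal (M * M) * W z := by
      refine (enorm_integral_le_lintegral_enorm _).trans ?_
      rw [hWdef, lconvolution_enorm, ← lintegral_const_mul' _ _ ENNReal.ofReal_ne_top]
      refine lintegral_mono fun t => ?_
      rw [mul_mul_mul_comm, enorm_mul]
      gcongr
      rw [← ofReal_norm, norm_mul]
      exact ENNReal.ofReal_le_ofReal (mul_le_mul (hM _ _) (hM _ _) (norm_nonneg _) hM0)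
    have h2 := ENNReal.toReal_mono (ENNReal.mul_ne_top ENNReal.ofReal_ne_top hz) h1
    rw [toReal_enorm, ENNReal.toReal_mul, ENNReal.toReal_ofReal (by positivity)] at h2
    rw [norm_mul, norm_mul, Complex.norm_real, Real.norm_of_nonneg ENNReal.toReal_nonneg,
      mul_left_comm]
    gcongr
  · filter_upwards [hfin] with z hz
    exact (h.tendsto_truncated_convolution hF hG hz).const_mul _

/-- A distribution whose Fourier transform is the convolution of the frequency functions of two
distributions is the product of these. -/
lemma IsDyadicPartition.isProduct_of_fourier (h : IsDyadicPartition φ χ) {a b p : 𝓢'(Plane, ℂ)}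
    {F G : Plane → ℂ} (hF : IsTempered F) (hG : IsTempered G)
    (ha : ∀ (n : ℤ) (θ : 𝓢(Plane, ℂ)), isoBlock χ n a θ =
      ∫ ξ, (𝓕⁻ θ) ξ * ((isoSymbol χ n ξ : ℂ) * F ξ))
    (hb : ∀ (n : ℤ) (θ : 𝓢(Plane, ℂ)), isoBlock χ n b θ =
      ∫ ξ, (𝓕⁻ θ) ξ * ((isoSymbol χ n ξ : ℂ) * G ξ))
    {s τ : ℝ} (hs : s ≤ 1 / 2) (hτ : τ ≤ 1 / 2)
    (hW : tileNorm s τ ((fun ξ => ‖F ξ‖ₑ) ⋆ₗ (fun ξ => ‖G ξ‖ₑ)) ≠ ⊤)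
    (hp : ∀ θ : 𝓢(Plane, ℂ), (𝓕 p) θ = ∫ z, θ z * ∫ t, F t * G (z - t)) :
    IsProduct χ a b p := by
  have hχ : ∀ n : ℤ, Measurable fun ξ => (isoSymbol χ n ξ : ℂ) := fun n =>
    (h.isRadialProfile_ball.hasTemperateGrowth_isoSymbol_complex n).1.continuous.measurable
  have hFm : ∀ n : ℤ, Measurable fun ξ => (isoSymbol χ n ξ : ℂ) * F ξ := fun n => (hχ n).mul hF.1
  have hFi := fun (n : ℤ) => hF.integrable_moment (hχ n) (h.rapidDecay_isoSymbol n)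
  have hFint := fun (n : ℤ) => hF.integrable_mul (hχ n) (h.rapidDecay_isoSymbol n)
  have hGint := fun (n : ℤ) => hG.integrable_mul (hχ n) (h.rapidDecay_isoSymbol n)
  -- The truncated frequency function has all moments, so its inverse transform is a smooth
  -- representative of S_n a with temperate growth.
  refine ⟨fun n => 𝓕⁻ fun ξ => (isoSymbol χ n ξ : ℂ) * F ξ,
    fun n => hasTemperateGrowth_fourierInv (hFm n) (hFi n), fun n => ?_, ?_⟩
  · ext θ
    rw [ha, ← integral_schwartz_mul_fourierInv _ (hFint n)]
    rfl
  · refine PointwiseConvergenceCLM.tendsto_iff_forall_tendsto.2 fun θ => ?_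
    simp_rw [fun n : ℕ => smulLeftCLM_fourierInv_apply (hFm n) (hFi n) (hGint n) (hb n) θ]
    have h1 : p θ = ∫ z, (𝓕⁻ θ) z * ∫ t, F t * G (z - t) := by
      rw [← hp, TemperedDistribution.fourier_apply, fourier_fourierInv_eq]
    rw [h1]
    exact h.tendsto_integral_truncated hF.1 hG.1 hs hτ hW _

lemma IsDyadicPartition.tendsto_horBlock (h : IsDyadicPartition φ χ) {p : 𝓢'(Plane, ℂ)}
    {H : Plane → ℂ} (hH : IsTempered H) (hp : ∀ θ : 𝓢(Plane, ℂ), (𝓕 p) θ = ∫ ξ, θ ξ * H ξ) :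
    Tendsto (fun k : ℤ => horBlock χ k p) atBot (𝓝 0) := by
  refine PointwiseConvergenceCLM.tendsto_iff_forall_tendsto.2 fun θ => ?_
  refine (h.tendsto_integral_horSymbol hH (𝓕⁻ θ)).congr fun k => ?_
  rw [horBlock_apply, hp]
  congr with ξ
  rw [SchwartzMap.smulLeftCLM_apply_apply
    (h.isRadialProfile_ball.hasTemperateGrowth_horSymbol_complex k), smul_eq_mul]

end Product

end AnisoBesov

end

/-! ### Assembly of the product law. -/

theorem mainTheorem8 (φ χ : ℝ → ℝ) (hφχ : AnisoBesov.IsDyadicPartition φ χ)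
    (s₁ s₂ τ₁ τ₂ : ℝ) (hs₁ : s₁ ≤ 1 / 2) (hs₂ : s₂ ≤ 1 / 2) (hτ₁ : τ₁ ≤ 1 / 2) (hτ₂ : τ₂ ≤ 1 / 2)
    (hs : 0 < s₁ + s₂) (hτ : 0 < τ₁ + τ₂) :
    ∃ C : ℝ≥0, ∀ a b : 𝓢'(AnisoBesov.Plane, ℂ),
      AnisoBesov.MemBesov φ χ s₁ τ₁ a → AnisoBesov.MemBesov φ χ s₂ τ₂ b →
      ∃ p : 𝓢'(AnisoBesov.Plane, ℂ), AnisoBesov.IsProduct χ a b p ∧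
        AnisoBesov.MemBesov φ χ (s₁ + s₂ - 1 / 2) (τ₁ + τ₂ - 1 / 2) p ∧
        AnisoBesov.besovNorm φ (s₁ + s₂ - 1 / 2) (τ₁ + τ₂ - 1 / 2) p ≤
          C * AnisoBesov.besovNorm φ s₁ τ₁ a * AnisoBesov.besovNorm φ s₂ τ₂ b := by
  obtain ⟨C₀, hC₀, hconv⟩ := AnisoBesov.exists_tileNorm_lconvolution_le hs₁ hs₂ hτ₁ hτ₂ hs hτ
  obtain ⟨C₁, hC₁, h₁⟩ := hφχ.exists_tileNorm_le s₁ τ₁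
  obtain ⟨C₂, hC₂, h₂⟩ := hφχ.exists_tileNorm_le s₂ τ₂
  obtain ⟨C₃, hC₃, h₃⟩ := hφχ.exists_freqNorm_le (s₁ + s₂ - 1 / 2) (τ₁ + τ₂ - 1 / 2)
  have hC : C₃ * (C₀ * C₁ * C₂) ≠ ⊤ := by finiteness
  refine ⟨(C₃ * (C₀ * C₁ * C₂)).toNNReal, fun a b ha hb => ?_⟩
  rw [ENNReal.coe_toNNReal hC]
  obtain ⟨F, hF, hFn, hFa⟩ := hφχ.exists_frequency hs₁ hτ₁ ha
  obtain ⟨G, hG, hGn, hGb⟩ := hφχ.exists_frequency hs₂ hτ₂ hb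
  have hU := h₁ _ hF.1.enorm
  have hV := h₂ _ hG.1.enorm
  rw [hFn] at hU
  rw [hGn] at hV
  have hUV := hconv _ _ hF.1.enorm hG.1.enorm
    (ne_top_of_le_ne_top (ENNReal.mul_ne_top hC₁ ha.1.ne) hU)
    (ne_top_of_le_ne_top (ENNReal.mul_ne_top hC₂ hb.1.ne) hV)
  have hUV' := hUV.trans (mul_le_mul' (mul_le_mul' le_rfl hU) hV)
  have hW := ne_top_of_le_ne_top (ENNReal.mul_ne_top (ENNReal.mul_ne_top hC₀
    (ENNReal.mul_ne_top hC₁ ha.1.ne)) (ENNReal.mul_ne_top hC₂ hb.1.ne)) hUV'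
  have hWm := measurable_lconvolution volume hF.1.enorm hG.1.enorm
  -- The output indices are again at most 1/2, so the convolution is itself tempered and defines a
  -- distribution.
  have hs' : s₁ + s₂ - 1 / 2 ≤ 1 / 2 := by linarith
  have hτ' : τ₁ + τ₂ - 1 / 2 ≤ 1 / 2 := by linarith
  have hH := AnisoBesov.isTempered_of_tileNorm hs' hτ'
    (AnisoBesov.measurable_integral_mul_sub hF.1 hG.1) hWm
    AnisoBesov.enorm_integral_mul_sub_le hW
  obtain ⟨T, hT⟩ := hH.exists_distribution
  have hp : ∀ θ : 𝓢(AnisoBesov.Plane, ℂ),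
      (FourierTransform.fourier (FourierTransformInv.fourierInv T)) θ =
        ∫ z, θ z * ∫ t, F t * G (z - t) := fun θ => by
    rw [FourierTransform.fourier_fourierInv_eq, hT]
  have hle : AnisoBesov.besovNorm φ (s₁ + s₂ - 1 / 2) (τ₁ + τ₂ - 1 / 2)
      (FourierTransformInv.fourierInv T) ≤
        C₃ * (C₀ * C₁ * C₂) * AnisoBesov.besovNorm φ s₁ τ₁ a *
          AnisoBesov.besovNorm φ s₂ τ₂ b := by
    refine (hφχ.besovNorm_le_freqNorm _ _ hH.1 hp).trans
      ((AnisoBesov.freqNorm_mono _ _ AnisoBesov.enorm_integral_mul_sub_le).trans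
        ((h₃ _ hWm).trans ((mul_le_mul' le_rfl hUV').trans_eq ?_)))
    ring
  refine ⟨FourierTransformInv.fourierInv T,
    hφχ.isProduct_of_fourier hF hG hFa hGb hs' hτ' hW hp, ⟨lt_of_le_of_lt hle ?_,
      hφχ.tendsto_horBlock hH hp⟩, hle⟩
  exact ENNReal.mul_lt_top (ENNReal.mul_lt_top hC.lt_top ha.1) hb.1
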